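/- Let $n\ge d\ge 1$, let $L=\{\ell_1,\dots,\ell_n\}$ and $R=\{r_1,\dots,r_d\}$, and identify bipartite graphs on $L\sqcup R$ with their edge sets. For a vector $v=(v_1,\dots,v_d)$ of positive integers with sum $k\le n$ and a $k$-subset $\sigma\subseteq L$, a *tope of type $v$ on $\sigma$* is a bipartite graph with right degree vector $v$ and left degree vector $e_\sigma$ (the characteristic vector of $\sigma$); a *tope field of type $v$* is a family $(M_\sigma)$ with one such tope for each $k$-subset $\sigma$ of $L$. An *$(n,d)$-matching field* is a tope field of type $(1,\dots,1)$. It is *linkage* if for every $r_i\in R$ and every $(d+1)$-subset $\tau\subseteq L$ there are distinct $\ell_j,\ell_{j'}\in\tau$ such that $M_{\tau\setminus\{\ell_j\}}$ and $M_{\tau\setminus\{\ell_{j'}\}}$ agree everywhere other than on $r_i$. An *$i$-amalgamation* of a tope field $(M_\sigma)$ of type $v$ and thickness $k<n$ is a tope field $(G_\tau)$ of type $v+e_i$ such that, for every $(k+1)$-subset $\tau\subseteq L$, $G_\tau$ is contained in the union of the topes $M_\sigma$ with $\sigma\subset\tau$. The *topes derived from* a matching field $\mathcal M$ are the members of all tope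 fields obtained from $\mathcal M$ by finitely many (possibly zero) amalgamations; they are ordered by inclusion of edge sets. The *flip graph* of $\mathcal M$ has the matchings $M_\sigma$ as nodes, two being adjacent iff they differ in one edge. The *prodsimplicial flag complex* $PF(G)$ of a graph $G$ has as cells the vertex sets $U$ on which $G$ induces a graph isomorphic to the $1$-skeleton of a product of simplices $\Delta_{a_1}\times\dots\times\Delta_{a_m}$ with $a_t\ge 0$ (in particular the vertices and edges of $G$ are cells); the faces of a cell are the products of nonempty faces of its factors. The *face lattice* of a complex is its poset of nonempty faces with a least element (the empty face) and a greatest element adjoined. **Theorem.** Let $\mathcal M$ be a linkage $(n,d)$-matching field, and let $PF$ be the prodsimplicial flag complex of its flip graph. 1. The map sending a cell $U$ of $PF$ to the union $\bigcup_{M_\sigma\in U}M_\sigma$ induces an isomorphism from the face lattice of $PF$ to the poset of topes derived from $\mathcal M$ with a least and a greatest element adjoined; these posets are indeed lattices. 2. The maximal cells of $PF$ are in bijection with the lattice points of $(n-d)\Delta_{d-1}=\{x\in\mathbb R^d_{\ge 0} : x_1+\dots+x_d=n-d\}$: a maximal cell whose union has right degree vector $v$ corresponds to the lattice point $v-(1,\dots,1)$.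 -/

import Mathlib

/-- A bipartite graph on the left nodes `ℓ_1, …, ℓ_n` and the right nodes `r_1, …, r_d`,
identified with its set of edges. -/
abbrev BipGraph (n d : ℕ) := Finset (Fin n × Fin d)

/-- The `k`-element subsets of the set of left nodes. -/
abbrev KSubset (n k : ℕ) := {σ : Finset (Fin n) // σ.card = k}

/-- The `k`-subset obtained from a `(k+1)`-subset `τ` by removing one of its elements. -/
def KSubset.remove {n k : ℕ} (τ : KSubset n (k + 1)) (j : Fin n) (hj : j ∈ τ.1) : KSubset n k :=
  ⟨τ.1.erase j, by rw [Finset.card_erase_of_mem hj, τ.2, Nat.add_sub_cancel]⟩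

namespace BipGraph

variable {n d : ℕ}

/-- The degree of a left node. -/
def leftDegree (T : BipGraph n d) (j : Fin n) : ℕ := (T.filter fun e => e.1 = j).card

/-- The degree of a right node. -/
def rightDegree (T : BipGraph n d) (i : Fin d) : ℕ := (T.filter fun e => e.2 = i).card

/-- `T` is a tope of type `v` on `σ`: its right degree vector is `v` and its left degree vector
is the characteristic vector of `σ`. -/
def IsTope (v : Fin d → ℕ) (σ : Finset (Fin n)) (T : BipGraph n d) : Prop :=
  (∀ i, T.rightDegree i = v i) ∧ ∀ j, T.leftDegree j = if j ∈ σ then 1 else 0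

end BipGraph

/-- An `(n, d)`-tope field of type `v` with thickness `k`: one tope of type `v` on each
`k`-subset of the left nodes, where `v` is a vector of positive integers with sum `k ≤ n`. -/
structure TopeField (n d k : ℕ) (v : Fin d → ℕ) where
  type_pos : ∀ i, 0 < v i
  sum_type : ∑ i, v i = k
  thickness_le : k ≤ n
  tope : KSubset n k → BipGraph n d
  isTope : ∀ σ, (tope σ).IsTope v σ.1

/-- An `(n, d)`-matching field: a tope field of thickness `d` and type `(1, …, 1)`, so that
`tope σ` is a perfect matching between the `d`-subset `σ` and the right nodes. -/
abbrev MatchingField (n d : ℕ) := TopeField n d d (fun _ => 1)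

namespace TopeField

variable {n d k : ℕ} {v : Fin d → ℕ}

/-- The union of the topes on the `k`-subsets of `τ`. -/
def covector (F : TopeField n d k v) (τ : Finset (Fin n)) : BipGraph n d :=
  (Finset.univ.filter fun σ : KSubset n k => σ.1 ⊆ τ).biUnion F.tope

/-- `G` is the `i`-amalgamation of `F`: a tope field of type `v + e_i` whose tope on each
`(k+1)`-subset `τ` is contained in the union of the topes of `F` on the `k`-subsets of `τ`. -/
def IsAmalgamation (i : Fin d) (F : TopeField n d k v)
    (G : TopeField n d (k + 1) (v + Pi.single i 1)) : Prop :=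
  ∀ τ : KSubset n (k + 1), G.tope τ ⊆ F.covector τ.1

end TopeField

namespace MatchingField

variable {n d : ℕ}

/-- The linkage axiom: for every right node `r_i` and every `(d+1)`-subset `τ` of the left nodes
there are distinct `j, j' ∈ τ` such that the matchings on `τ \ {j}` and `τ \ {j'}` agree
everywhere other than on `r_i`. -/
def IsLinkage (M : MatchingField n d) : Prop :=
  ∀ (i : Fin d) (τ : KSubset n (d + 1)),
    ∃ (j : Fin n) (hj : j ∈ τ.1) (j' : Fin n) (hj' : j' ∈ τ.1), j ≠ j' ∧
      ∀ e : Fin n × Fin d, e.2 ≠ i →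
        (e ∈ M.tope (τ.remove j hj) ↔ e ∈ M.tope (τ.remove j' hj'))

/-- The tope fields obtained from `M` by iterated amalgamation. -/
inductive Derives (M : MatchingField n d) :
    ∀ {k : ℕ} {v : Fin d → ℕ}, TopeField n d k v → Prop
  | base : Derives M M
  | step {k : ℕ} {v : Fin d → ℕ} {F : TopeField n d k v} (i : Fin d)
      (G : TopeField n d (k + 1) (v + Pi.single i 1)) :
      Derives M F → F.IsAmalgamation i G → Derives M G

/-- The topes derived from `M`, i.e. the members of the tope fields obtained from `M` by
iterated amalgamation. As a subtype of the edge sets they are ordered by inclusion. -/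
abbrev DerivedTope (M : MatchingField n d) : Type :=
  {T : BipGraph n d // ∃ (k : ℕ) (v : Fin d → ℕ) (F : TopeField n d k v),
    M.Derives F ∧ ∃ σ : KSubset n k, F.tope σ = T}

/-- The flip graph. Its nodes are the matchings of `M`, each indexed by the `d`-subset it
covers; two matchings are adjacent iff they differ in one edge. -/
def flipGraph (M : MatchingField n d) : SimpleGraph (KSubset n d) where
  Adj σ σ' := (M.tope σ \ M.tope σ').card = 1 ∧ (M.tope σ' \ M.tope σ).card = 1
  symm := ⟨fun _ _ h => ⟨h.2, h.1⟩⟩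
  loopless := ⟨fun σ h => by simp at h⟩

/-- The union of a set of matchings of `M`. -/
def unionMatchings (M : MatchingField n d) (U : Finset (KSubset n d)) : BipGraph n d :=
  U.biUnion M.tope

end MatchingField

/-- The `1`-skeleton of the product of simplices `Δ_{a_1} × ⋯ × Δ_{a_m}`: its vertices are the
tuples of vertices of the factors, and two of them span an edge iff they differ in exactly one
coordinate. -/
def prodSimplexGraph {m : ℕ} (a : Fin m → ℕ) : SimpleGraph (∀ t, Fin (a t + 1)) where
  Adj x y := hammingDist x y = 1
  symm := ⟨fun x y h => by rwa [hammingDist_comm]⟩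
  loopless := ⟨fun x h => by simp at h⟩

/-- A cell of the prodsimplicial flag complex of `G`, given by its vertices: a set of vertices on
which `G` induces the `1`-skeleton of a product of simplices. (The decomposition of such a graph
as a product of complete graphs is unique up to reordering, so the vertex set carries the
product structure of the cell.) -/
structure ProdsimplicialCell {V : Type*} (G : SimpleGraph V) where
  verts : Finset V
  isProd : ∃ (m : ℕ) (a : Fin m → ℕ),
    Nonempty (G.induce (verts : Set V) ≃g prodSimplexGraph a)

namespace ProdsimplicialCell

variable {V : Type*} {G : SimpleGraph V}

/-- `U` is a face of `W`: in some identification of `W` with a product of simplices, `U` is a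
product of nonempty faces of the factors. -/
def IsFace (U W : ProdsimplicialCell G) : Prop :=
  ∃ (m : ℕ) (a : Fin m → ℕ) (φ : G.induce (W.verts : Set V) ≃g prodSimplexGraph a)
    (S : ∀ t, Set (Fin (a t + 1))),
    (∀ t, (S t).Nonempty) ∧
      ∀ x : V, x ∈ U.verts ↔ ∃ hx : x ∈ (W.verts : Set V), ∀ t, φ ⟨x, hx⟩ t ∈ S t

/-- The cells of the prodsimplicial flag complex are ordered by the face relation. -/
instance : LE (ProdsimplicialCell G) := ⟨IsFace⟩

end ProdsimplicialCell

/-- The face lattice of a complex with face order `P`: the nonempty faces, the empty face `⊥` and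
a formal greatest element `⊤`. -/
abbrev FaceLattice (P : Type*) := WithBot (WithTop P)

/-- The lattice points of the dilated simplex
`(n - d) Δ_{d-1} = {x ∈ ℝ^d | x ≥ 0, x_1 + ⋯ + x_d = n - d}`. -/
def dilatedSimplexPoints (n d : ℕ) : Set (Fin d → ℤ) :=
  {p | (∀ i, 0 ≤ p i) ∧ ∑ i, p i = (n : ℤ) - d}

/-! A tope is treated as the family of its fibres over the right nodes. It is called compatible if
every transversal of the fibres is a matching of the field. The theorem follows once derived topes
and cells of $PF$ are both identified with families of nonempty fibres all of whose transversals are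
matchings (`IsProduct`).

For derived topes the main point is that a linkage matching field has exactly one compatible tope
for each type $v$ and each set of $|v|$ left nodes (`IsLinkageSystem.hasTopes_and_topesUnique`). The
proof is an induction on thickness. Two compatible topes that differ by exchanging $x$ and $y$ in
one fibre glue to a tope one larger. A count of hypergraph components shows that the $i$-th fibre of
the tope of type $v$ on $\tau\setminus\{j\}$ is the $i$-th fibre of the tope of type $v+e_i$ on
$\tau$ minus one node; this yields uniqueness and the pairs to glue. An amalgamation can then only
produce the compatible tope (`IsCompatible.eq_of_subset_covector`), and every type is reached.

For cells, adjacency in the flip graph is Hamming distance one between matchings viewed as functions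
$R\to L$. An induced embedding of a Hamming graph into another has a product of sets as image
(`exists_eq_of_hammingDist_embedding`), so a cell consists of all transversals of the fibres of its
union.

Under these identifications the face order is inclusion of fibres and meets are intersections. A
compatible tope that misses a left node can be enlarged, so the maximal cells are the compatible
topes on all of $L$, exactly one for each positive $v$ with sum $n$. -/

/-! ### Compatible topes, gluing, and a connected hypergraph -/

section Combinatorics

open Finset

variable {α ι : Type*} [DecidableEq α]

/-- The family `T` of fibres is a tope of type `v` on `σ`, all of whose transversals belong to
`𝓜`. -/
structure IsCompatible (𝓜 : Set (ι → α)) (v : ι → ℕ) (σ : Finset α) (T : ι → Finset α) :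
    Prop where
  card_eq : ∀ i, (T i).card = v i
  mem_iff : ∀ x, x ∈ σ ↔ ∃ i, x ∈ T i
  unique : ∀ ⦃x i i'⦄, x ∈ T i → x ∈ T i' → i = i'
  mem_of_transversal : ∀ s : ι → α, (∀ i, s i ∈ T i) → s ∈ 𝓜

/-- Remove a left node from all fibres. -/
def eraseNode (T : ι → Finset α) (x : α) : ι → Finset α := fun i => (T i).erase x

/-- Add a left node to the fibre of `i`. -/
def insertNode [DecidableEq ι] (T : ι → Finset α) (i : ι) (x : α) : ι → Finset α :=
  fun k => if k = i then insert x (T k) else T k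

theorem mem_eraseNode {T : ι → Finset α} {x y : α} {i : ι} :
    y ∈ eraseNode T x i ↔ y ≠ x ∧ y ∈ T i := Finset.mem_erase

theorem eraseNode_comm (T : ι → Finset α) (x y : α) :
    eraseNode (eraseNode T x) y = eraseNode (eraseNode T y) x := by
  ext i z; simp only [mem_eraseNode]; tauto

section

variable [DecidableEq ι]

theorem mem_insertNode {T : ι → Finset α} {x y : α} {i k : ι} :
    y ∈ insertNode T i x k ↔ (y = x ∧ k = i) ∨ y ∈ T k := by
  unfold insertNode
  split_ifs with h
  · simp [h]
  · simp [h]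

theorem eraseNode_insertNode {T : ι → Finset α} {x : α} (h : ∀ i, x ∉ T i) (i : ι) :
    eraseNode (insertNode T i x) x = T := by
  ext k z
  simp only [mem_eraseNode, mem_insertNode]
  constructor
  · tauto
  · intro hz
    exact ⟨fun e => h k (e ▸ hz), Or.inr hz⟩

theorem eraseNode_insertNode_of_ne (T : ι → Finset α) {x y : α} (h : x ≠ y) (i : ι) :
    eraseNode (insertNode T i x) y = insertNode (eraseNode T y) i x := by
  ext k z
  simp only [mem_eraseNode, mem_insertNode]
  constructor
  · tauto
  · rintro (⟨rfl, rfl⟩ | hz)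
    · exact ⟨h, Or.inl ⟨rfl, rfl⟩⟩
    · tauto

namespace IsCompatible

variable {𝓜 : Set (ι → α)} {v : ι → ℕ} {σ : Finset α} {T : ι → Finset α}

theorem subset (h : IsCompatible 𝓜 v σ T) (i : ι) : T i ⊆ σ :=
  fun x hx => (h.mem_iff x).2 ⟨i, hx⟩

theorem insertNode_eraseNode (h : IsCompatible 𝓜 v σ T) {i : ι} {x : α} (hx : x ∈ T i) :
    insertNode (eraseNode T x) i x = T := by
  ext k z
  simp only [mem_eraseNode, mem_insertNode]
  constructor
  · rintro (⟨rfl, rfl⟩ | hz)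
    · exact hx
    · exact hz.2
  · intro hz
    by_cases hzx : z = x
    · subst hzx; exact Or.inl ⟨rfl, h.unique hz hx⟩
    · exact Or.inr ⟨hzx, hz⟩

theorem eraseNode_apply_of_ne (h : IsCompatible 𝓜 v σ T) {i k : ι} {x : α} (hx : x ∈ T i)
    (hk : k ≠ i) : eraseNode T x k = T k :=
  Finset.erase_eq_of_notMem fun hx' => hk (h.unique hx' hx)

theorem eraseNode {i : ι} {x : α} (h : IsCompatible 𝓜 (v + Pi.single i 1) σ T) (hx : x ∈ T i) :
    IsCompatible 𝓜 v (σ.erase x) (eraseNode T x) where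
  card_eq k := by
    by_cases hk : k = i
    · subst hk
      have := h.card_eq k
      simp only [Pi.add_apply, Pi.single_eq_same] at this
      rw [show _root_.eraseNode T x k = (T k).erase x from rfl, card_erase_of_mem hx, this]
      omega
    · rw [h.eraseNode_apply_of_ne hx hk, h.card_eq k]
      simp [hk]
  mem_iff y := by simp [mem_eraseNode, h.mem_iff y]
  unique y a b ha hb := h.unique (mem_eraseNode.1 ha).2 (mem_eraseNode.1 hb).2
  mem_of_transversal s hs := h.mem_of_transversal s fun i => (mem_eraseNode.1 (hs i)).2

/-- Both $x$ and $y$ go into the fibre of $i$, so a transversal of the enlarged family meets at most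
one of them. It is therefore a transversal of $P$ (if it avoids $x$) or of $Q$ (if it avoids $y$).
-/
theorem glue {i : ι} {x y : α} {P Q : ι → Finset α} (hP : IsCompatible 𝓜 v (σ.erase x) P)
    (hQ : IsCompatible 𝓜 v (σ.erase y) Q) (hy : y ∈ P i) (hx : x ∈ Q i)
    (hPQ : _root_.eraseNode P y = _root_.eraseNode Q x) :
    ∃ T, IsCompatible 𝓜 (v + Pi.single i 1) σ T ∧ x ∈ T i ∧ y ∈ T i := by
  have hxP : ∀ k, x ∉ P k := fun k hk => by simpa using hP.subset k hk
  have hyQ : ∀ k, y ∉ Q k := fun k hk => by simpa using hQ.subset k hk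
  have hxy : x ≠ y := by rintro rfl; exact hxP i hy
  have hyσ : y ∈ σ := Finset.mem_of_mem_erase (hP.subset i hy)
  have hxσ : x ∈ σ := Finset.mem_of_mem_erase (hQ.subset i hx)
  have hTx : _root_.eraseNode (insertNode P i x) x = P := eraseNode_insertNode hxP i
  have hTy : _root_.eraseNode (insertNode P i x) y = Q := by
    rw [eraseNode_insertNode_of_ne _ hxy, hPQ, hQ.insertNode_eraseNode hx]
  refine ⟨insertNode P i x, ⟨?_, ?_, ?_, ?_⟩, mem_insertNode.2 (Or.inl ⟨rfl, rfl⟩),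
    mem_insertNode.2 (Or.inr hy)⟩
  · intro k
    unfold insertNode
    split_ifs with hk
    · subst hk
      rw [card_insert_of_notMem (hxP k), hP.card_eq]; simp
    · rw [hP.card_eq]; simp [hk]
  · intro z
    simp only [mem_insertNode]
    have := hP.mem_iff z
    rw [Finset.mem_erase] at this
    by_cases hz : z = x
    · subst hz; simp [hxσ]
    · simpa [hz] using this
  · intro z a b ha hb
    rw [mem_insertNode] at ha hb
    rcases ha with ⟨rfl, rfl⟩ | ha <;> rcases hb with ⟨h1, rfl⟩ | hb
    · rfl
    · exact absurd hb (hxP _)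
    · subst h1; exact absurd ha (hxP _)
    · exact hP.unique ha hb
  · intro s hs
    have key : ∀ k, k ≠ i → s k ≠ x ∧ s k ≠ y := by
      intro k hk
      have h1 := hs k
      simp only [mem_insertNode, hk, and_false, false_or] at h1
      exact ⟨fun e => hxP k (e ▸ h1), fun e => hk (hP.unique (e ▸ h1) hy)⟩
    by_cases hsx : s i = x
    · refine hQ.mem_of_transversal s fun k => ?_
      rw [← hTy, mem_eraseNode]
      refine ⟨?_, hs k⟩
      by_cases hk : k = i
      · subst hk; rw [hsx]; exact hxy
      · exact (key k hk).2
    · refine hP.mem_of_transversal s fun k => ?_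
      rw [← hTx, mem_eraseNode]
      refine ⟨?_, hs k⟩
      by_cases hk : k = i
      · subst hk; exact hsx
      · exact (key k hk).1

end IsCompatible

end

/-- The hypergraph with edges `E i` is connected, since each of its components `c` has more than
`∑ v i` vertices, the sum being over the edges in `c`. -/
theorem exists_eq_erase_of_hyperedges [Fintype ι] {v : ι → ℕ} {τ : Finset α}
    (hτ : τ.card = ∑ i, v i + 1) {F : α → ι → Finset α} {E : ι → Finset α}
    (hEne : ∀ i, (E i).Nonempty) (hEτ : ∀ i, E i ⊆ τ)
    (hcard : ∀ j ∈ τ, ∀ i, (F j i).card = v i) (hnot : ∀ j ∈ τ, ∀ i, j ∉ F j i)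
    (huniq : ∀ j ∈ τ, ∀ x i i', x ∈ F j i → x ∈ F j i' → i = i')
    (hE : ∀ i, ∀ j ∈ E i, F j i = (E i).erase j)
    (hF : ∀ i, ∀ j ∈ E i, ∀ j' ∈ E i, ∀ k, k ≠ i → F j k = F j' k) :
    ∀ j ∈ τ, ∀ i, ∃ x ∈ E i, F j i = (E i).erase x := by
  classical
  let r : α → α → Prop := fun a b => ∃ i, a ∈ E i ∧ b ∈ E i
  let q : α → Quot r := Quot.mk r
  have hq : ∀ i, ∀ a ∈ E i, ∀ b ∈ E i, q a = q b := fun i a ha b hb => Quot.sound ⟨i, ha, hb⟩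
  -- Moving along the edge `E k` changes only the fibre of `k`. For `k = i` the property holds at
  -- both ends, so it is constant on components.
  have inv : ∀ i a b, q a = q b → ((∃ x ∈ E i, F a i = (E i).erase x) ↔
      ∃ x ∈ E i, F b i = (E i).erase x) := by
    intro i a b hab
    induction Quot.eqvGen_exact hab with
    | rel a b h =>
      obtain ⟨k, ha, hb⟩ := h
      by_cases hk : i = k
      · subst hk
        exact ⟨fun _ => ⟨b, hb, hE i b hb⟩, fun _ => ⟨a, ha, hE i a ha⟩⟩
      · rw [hF k a ha b hb i hk]
    | refl => rfl
    | symm a b h ih => exact (ih (Quot.eqvGen_sound h)).symm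
    | trans a b c h1 h2 ih1 ih2 =>
      exact (ih1 (Quot.eqvGen_sound h1)).trans (ih2 (Quot.eqvGen_sound h2))
  choose p hp using hEne
  have claim : ∀ i j, q j = q (p i) → ∃ x ∈ E i, F j i = (E i).erase x :=
    fun i j h => (inv i j (p i) h).2 ⟨p i, hp i, hE i _ (hp i)⟩
  -- A component containing `j` also contains the disjoint fibres `F j i` for its own edges `E i`,
  -- none of which contains `j`; hence the extra 1.
  have comp : ∀ c ∈ τ.image q, ∑ i with q (p i) = c, v i + 1 ≤ (τ.filter (q · = c)).card := by
    intro c hc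
    obtain ⟨j, hj, rfl⟩ := Finset.mem_image.1 hc
    have hdisj : ((univ.filter fun i => q (p i) = q j : Finset ι) : Set ι).PairwiseDisjoint
        (F j) := by
      intro a _ b _ hab
      exact Finset.disjoint_left.2 fun x hxa hxb => hab (huniq j hj x a b hxa hxb)
    have hsub : insert j ((univ.filter fun i => q (p i) = q j).biUnion (F j)) ⊆
        τ.filter (q · = q j) := by
      intro x hx
      rw [Finset.mem_insert, Finset.mem_biUnion] at hx
      rw [Finset.mem_filter]
      rcases hx with rfl | ⟨i, hi, hx⟩
      · exact ⟨hj, rfl⟩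
      · have hi := (Finset.mem_filter.1 hi).2
        obtain ⟨y, hy, hFy⟩ := claim i j hi.symm
        rw [hFy] at hx
        have hxE := Finset.mem_of_mem_erase hx
        exact ⟨hEτ i hxE, (hq i x hxE _ (hp i)).trans hi⟩
    have := Finset.card_le_card hsub
    rw [card_insert_of_notMem, Finset.card_biUnion hdisj,
      Finset.sum_congr rfl fun i _ => hcard j hj i] at this
    · exact this
    · rw [Finset.mem_biUnion]
      rintro ⟨i, _, h⟩
      exact hnot j hj i h
  -- Summing over components gives `τ.card ≥ ∑ v i` plus the number of components, which leaves room
  -- for only one.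
  have hsum := Finset.sum_le_sum comp
  rw [Finset.sum_add_distrib, ← Finset.card_eq_sum_card_image,
    Finset.sum_fiberwise_of_maps_to (fun i _ => Finset.mem_image_of_mem q (hEτ i (hp i))), hτ,
    ← Finset.card_eq_sum_ones] at hsum
  have hone : (τ.image q).card ≤ 1 := by omega
  intro j hj i
  exact claim i j (Finset.card_le_one.1 hone _ (Finset.mem_image_of_mem q hj) _
    (Finset.mem_image_of_mem q (hEτ i (hp i))))

end Combinatorics

/-! ### Existence and uniqueness of compatible topes of every type -/

section Completeness

open Finset

variable {α ι : Type*} [DecidableEq α] [DecidableEq ι] [Fintype ι]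

/-- For each type of thickness `k` there is a compatible tope on each `k`-set. -/
def HasTopes (𝓜 : Set (ι → α)) (k : ℕ) : Prop :=
  ∀ v : ι → ℕ, (∀ i, 0 < v i) → ∑ i, v i = k → ∀ σ : Finset α, σ.card = k →
    ∃ T, IsCompatible 𝓜 v σ T

/-- For each type of thickness `k` there is at most one compatible tope on each `k`-set. -/
def TopesUnique (𝓜 : Set (ι → α)) (k : ℕ) : Prop :=
  ∀ v : ι → ℕ, (∀ i, 0 < v i) → ∑ i, v i = k → ∀ σ : Finset α, σ.card = k →
    ∀ T T', IsCompatible 𝓜 v σ T → IsCompatible 𝓜 v σ T' → T = T'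

theorem sum_add_single (v : ι → ℕ) (i : ι) :
    ∑ k, (v + Pi.single i 1 : ι → ℕ) k = ∑ k, v k + 1 := by
  simp [Finset.sum_add_distrib]

theorem add_single_pos {v : ι → ℕ} (hv : ∀ k, 0 < v k) (i k : ι) :
    0 < (v + Pi.single i 1 : ι → ℕ) k := by
  have := hv k
  simp only [Pi.add_apply]
  omega

theorem exists_eq_add_single {w : ι → ℕ} (hw : ∀ k, 0 < w k) (h : Fintype.card ι < ∑ k, w k) :
    ∃ (v : ι → ℕ) (i : ι), (∀ k, 0 < v k) ∧ w = v + Pi.single i 1 := by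
  obtain ⟨i, hi⟩ : ∃ i, 1 < w i := by
    by_contra! hc
    have := Finset.sum_le_sum fun i (_ : i ∈ Finset.univ) => hc i
    simp at this
    omega
  refine ⟨Function.update w i (w i - 1), i, fun k => ?_, ?_⟩
  · by_cases hk : k = i
    · subst hk; simp; omega
    · simpa [hk] using hw k
  · ext k
    by_cases hk : k = i
    · subst hk; simp; omega
    · simp [hk]

theorem eq_one_of_sum_eq_card {v : ι → ℕ} (hv : ∀ k, 0 < v k) (h : ∑ k, v k = Fintype.card ι) :
    v = fun _ => 1 := by
  have h1 : ∑ k : ι, 1 = ∑ k, v k := by simp [h]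
  have := (Finset.sum_eq_sum_iff_of_le fun i (_ : i ∈ Finset.univ) => hv i).1 h1
  ext k
  exact (this k (Finset.mem_univ k)).symm

variable {𝓜 : Set (ι → α)} {k : ℕ}

/-- The hypergraph lemma is applied to the topes of type `v` on the sets `τ.erase x` and to the
`a`-th fibres of topes of type `v + e_a` on `τ`. The tope for `a = i` is chosen to be `T`. For `j ∈
T i` the claim is plain uniqueness; the gain is that `j` may lie in any fibre. -/
theorem IsCompatible.exists_eq_erase {v : ι → ℕ} {i : ι} {τ : Finset α} {T P : ι → Finset α}
    {j : α} (hex : HasTopes 𝓜 k) (hun : TopesUnique 𝓜 k) (hex' : HasTopes 𝓜 (k + 1))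
    (hv : ∀ i, 0 < v i) (hvk : ∑ i, v i = k) (hT : IsCompatible 𝓜 (v + Pi.single i 1) τ T)
    (hτ : τ.card = k + 1) (hj : j ∈ τ) (hP : IsCompatible 𝓜 v (τ.erase j) P) :
    ∃ x ∈ T i, P i = (T i).erase x := by
  have hcard : ∀ x ∈ τ, (τ.erase x).card = k := fun x hx => by
    rw [card_erase_of_mem hx, hτ]; rfl
  have hF : ∀ x, ∃ F, x ∈ τ → IsCompatible 𝓜 v (τ.erase x) F := fun x => by
    by_cases hx : x ∈ τ
    · obtain ⟨F, hF⟩ := hex v hv hvk _ (hcard x hx)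
      exact ⟨F, fun _ => hF⟩
    · exact ⟨fun _ => ∅, fun h => absurd h hx⟩
  choose F hF using hF
  have hE : ∀ a, ∃ E, IsCompatible 𝓜 (v + Pi.single a 1) τ E ∧ (a = i → E = T) := fun a => by
    by_cases ha : a = i
    · subst ha; exact ⟨T, hT, fun _ => rfl⟩
    · obtain ⟨E, hE⟩ := hex' (v + Pi.single a 1) (add_single_pos hv a)
        (by rw [sum_add_single, hvk]) τ hτ
      exact ⟨E, hE, fun h => absurd h ha⟩
  choose E hE hET using hE
  have herase : ∀ a, ∀ x ∈ E a a, F x = _root_.eraseNode (E a) x := fun a x hx =>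
    hun v hv hvk _ (hcard x ((hE a).subset a hx)) _ _ (hF x ((hE a).subset a hx))
      ((hE a).eraseNode hx)
  have := exists_eq_erase_of_hyperedges (v := v) (τ := τ) (F := F) (E := fun a => E a a)
    (by rw [hτ, hvk])
    (fun a => card_pos.1 (by rw [(hE a).card_eq]; exact add_single_pos hv a a))
    (fun a => (hE a).subset a) (fun x hx a => (hF x hx).card_eq a)
    (fun x hx a h => by simpa using (hF x hx).subset a h)
    (fun x hx y a b => @(hF x hx).unique y a b)
    (fun a x hx => by rw [herase a x hx]; rfl)
    (fun a x hx y hy b hb => by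
      rw [herase a x hx, herase a y hy, (hE a).eraseNode_apply_of_ne hx hb,
        (hE a).eraseNode_apply_of_ne hy hb]) j hj i
  rw [hun v hv hvk _ (hcard j hj) _ _ hP (hF j hj), ← hET i rfl]
  exact this

/-- Two topes of type `v + e_i` share a node `a` in their `i`-th fibres, because both of these
contain the nonempty `i`-th fibre of one tope of type `v`. Removing `a` reduces to uniqueness for
`v`. -/
theorem TopesUnique.succ (hk : Fintype.card ι ≤ k) (hex : HasTopes 𝓜 k)
    (hun : TopesUnique 𝓜 k) (hex' : HasTopes 𝓜 (k + 1)) : TopesUnique 𝓜 (k + 1) := by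
  intro w hw hwk τ hτ T T' hT hT'
  obtain ⟨v, i, hv, rfl⟩ := exists_eq_add_single hw (by omega)
  have hvk : ∑ k, v k = k := by rw [sum_add_single] at hwk; omega
  obtain ⟨j, hj⟩ : (T' i).Nonempty := card_pos.1 (by rw [hT'.card_eq]; exact hw i)
  have hP := hT'.eraseNode hj
  obtain ⟨x, hx, hxT⟩ := hT.exists_eq_erase hex hun hex' hv hvk hτ (hT'.subset i hj) hP
  obtain ⟨a, ha⟩ : (eraseNode T' j i).Nonempty := card_pos.1 (by rw [hP.card_eq]; exact hv i)
  have haT' : a ∈ T' i := (mem_eraseNode.1 ha).2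
  have haT : a ∈ T i := by rw [hxT] at ha; exact mem_of_mem_erase ha
  rw [← hT.insertNode_eraseNode haT, ← hT'.insertNode_eraseNode haT']
  congr 1
  exact hun v hv hvk _ (by rw [card_erase_of_mem (hT.subset i haT), hτ]; rfl) _ _
    (hT.eraseNode haT) (hT'.eraseNode haT')

/-- The `i`-th fibres of the topes of type `v + e_i` on `ρ \ {x}` and `ρ \ {y}` share all but one
of their elements. -/
theorem le_card_inter_of_isCompatible {v : ι → ℕ} {i : ι} {ρ : Finset α}
    {G G' : ι → Finset α} {x y : α}
    (hex : HasTopes 𝓜 k) (hun : TopesUnique 𝓜 k) (hex' : HasTopes 𝓜 (k + 1))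
    (hv : ∀ i, 0 < v i) (hvk : ∑ i, v i = k) (hρ : ρ.card = k + 2) (hx : x ∈ ρ) (hy : y ∈ ρ)
    (hxy : x ≠ y) (hG : IsCompatible 𝓜 (v + Pi.single i 1) (ρ.erase x) G)
    (hG' : IsCompatible 𝓜 (v + Pi.single i 1) (ρ.erase y) G') :
    v i ≤ (G i ∩ G' i).card := by
  have hyx : y ∈ ρ.erase x := mem_erase.2 ⟨hxy.symm, hy⟩
  have hxy' : x ∈ ρ.erase y := mem_erase.2 ⟨hxy, hx⟩
  have c1 : (ρ.erase x).card = k + 1 := by rw [card_erase_of_mem hx, hρ]; rfl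
  have c2 : (ρ.erase y).card = k + 1 := by rw [card_erase_of_mem hy, hρ]; rfl
  obtain ⟨P, hP⟩ := hex v hv hvk ((ρ.erase x).erase y) (by rw [card_erase_of_mem hyx, c1]; rfl)
  have hP' := hP
  rw [erase_right_comm] at hP'
  obtain ⟨a, _, h1⟩ := hG.exists_eq_erase hex hun hex' hv hvk c1 hyx hP
  obtain ⟨b, _, h2⟩ := hG'.exists_eq_erase hex hun hex' hv hvk c2 hxy' hP'
  rw [← hP.card_eq i]
  refine card_le_card (subset_inter ?_ ?_)
  · rw [h1]; exact erase_subset _ _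
  · rw [h2]; exact erase_subset _ _

/-- Topes whose type arises by increasing the same entry twice. -/
theorem exists_isCompatible_add_single_add_single {v : ι → ℕ} {i : ι} {ρ : Finset α}
    (hex : HasTopes 𝓜 k) (hun : TopesUnique 𝓜 k) (hex' : HasTopes 𝓜 (k + 1))
    (hv : ∀ i, 0 < v i) (hvk : ∑ i, v i = k) (hρ : ρ.card = k + 2) :
    ∃ T, IsCompatible 𝓜 (v + Pi.single i 1 + Pi.single i 1) ρ T := by
  have hw := add_single_pos hv i
  have hwk : ∑ k, (v + Pi.single i 1 : ι → ℕ) k = k + 1 := by rw [sum_add_single, hvk]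
  have hwi : (v + Pi.single i 1 : ι → ℕ) i = v i + 1 := by simp
  have hG : ∀ x, ∃ G, x ∈ ρ → IsCompatible 𝓜 (v + Pi.single i 1) (ρ.erase x) G := fun x => by
    by_cases hx : x ∈ ρ
    · obtain ⟨G, hG⟩ := hex' _ hw hwk (ρ.erase x) (by rw [card_erase_of_mem hx, hρ]; rfl)
      exact ⟨G, fun _ => hG⟩
    · exact ⟨fun _ => ∅, fun h => absurd h hx⟩
  choose G hG using hG
  have hsub : ∀ x ∈ ρ, ∀ y, y ∈ G x i → y ∈ ρ ∧ y ≠ x := fun x hx y hy => by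
    have := (hG x hx).subset i hy
    rw [mem_erase] at this
    exact ⟨this.2, this.1⟩
  have hinter : ∀ x ∈ ρ, ∀ y ∈ ρ, x ≠ y → v i ≤ (G x i ∩ G y i).card := fun x hx y hy hxy =>
    le_card_inter_of_isCompatible hex hun hex' hv hvk hρ hx hy hxy (hG x hx) (hG y hy)
  obtain ⟨x, hx⟩ : ρ.Nonempty := card_pos.1 (by omega)
  obtain ⟨y, hy⟩ : (G x i).Nonempty := card_pos.1 (by rw [(hG x hx).card_eq]; exact hw i)
  have hyρ := (hsub x hx y hy).1
  have hyx := (hsub x hx y hy).2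
  obtain ⟨z, hz⟩ : (G x i ∩ G y i).Nonempty :=
    card_pos.1 ((hv i).trans_le (hinter x hx y hyρ hyx.symm))
  rw [mem_inter] at hz
  have hzρ := (hsub x hx z hz.1).1
  have hzx := (hsub x hx z hz.1).2
  have hzy := (hsub y hyρ z hz.2).2
  -- Otherwise `G x i ∩ G z i` would miss both `y` and `z` among the `v i + 1` elements of `G x i`,
  -- against the bound `v i`. Then `y` and `z` can be exchanged and the topes glue.
  have hyz : y ∈ G z i := by
    by_contra hyz
    have hlt : G x i ∩ G z i ⊆ ((G x i).erase z).erase y := fun u hu => by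
      rw [mem_inter] at hu
      exact mem_erase.2 ⟨fun e => hyz (e ▸ hu.2), mem_erase.2 ⟨(hsub z hzρ u hu.2).2, hu.1⟩⟩
    have := card_le_card hlt
    rw [card_erase_of_mem (mem_erase.2 ⟨hzy.symm, hy⟩), card_erase_of_mem hz.1,
      (hG x hx).card_eq, hwi] at this
    have := hinter x hx z hzρ hzx.symm
    have := hv i
    omega
  obtain ⟨T, hT, -⟩ := (hG y hyρ).glue (hG z hzρ) hz.2 hyz (hun v hv hvk ((ρ.erase y).erase z)
    (by rw [card_erase_of_mem (mem_erase.2 ⟨hzy, hzρ⟩), card_erase_of_mem hyρ, hρ]; rfl) _ _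
    ((hG y hyρ).eraseNode hz.2)
    (by rw [erase_right_comm]; exact (hG z hzρ).eraseNode hyz))
  exact ⟨T, hT⟩

/-- Topes whose type arises by increasing two different entries. -/
theorem exists_isCompatible_add_single_add_single_of_ne {v : ι → ℕ} {i l : ι} {ρ : Finset α}
    (hex : HasTopes 𝓜 k) (hun : TopesUnique 𝓜 k) (hex' : HasTopes 𝓜 (k + 1))
    (hun' : TopesUnique 𝓜 (k + 1)) (hv : ∀ i, 0 < v i) (hvk : ∑ i, v i = k)
    (hρ : ρ.card = k + 2) (hli : l ≠ i) :
    ∃ T, IsCompatible 𝓜 (v + Pi.single i 1 + Pi.single l 1) ρ T := by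
  have hw := add_single_pos hv i
  have hwk : ∑ k, (v + Pi.single i 1 : ι → ℕ) k = k + 1 := by rw [sum_add_single, hvk]
  have hwi : (v + Pi.single i 1 : ι → ℕ) i = v i + 1 := by simp
  have hwl : (v + Pi.single i 1 : ι → ℕ) l = v l := by simp [hli]
  have hcard : ∀ x ∈ ρ, (ρ.erase x).card = k + 1 := fun x hx => by
    rw [card_erase_of_mem hx, hρ]; rfl
  have hcard2 : ∀ x ∈ ρ, ∀ y ∈ ρ, x ≠ y → ((ρ.erase x).erase y).card = k :=
    fun x hx y hy hxy => by
      rw [card_erase_of_mem (mem_erase.2 ⟨hxy.symm, hy⟩), hcard x hx]; rfl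
  -- The tope of type `v + 2e_i` on `ρ` serves as a reference for the topes `G x` of type `v + e_i`.
  obtain ⟨f, hf⟩ := exists_isCompatible_add_single_add_single (i := i) hex hun hex' hv hvk hρ
  have hfi : (f i).card = v i + 2 := by rw [hf.card_eq]; simp
  have hG : ∀ x, ∃ G, x ∈ ρ → IsCompatible 𝓜 (v + Pi.single i 1) (ρ.erase x) G := fun x => by
    by_cases hx : x ∈ ρ
    · obtain ⟨G, hG⟩ := hex' _ hw hwk (ρ.erase x) (hcard x hx)
      exact ⟨G, fun _ => hG⟩
    · exact ⟨fun _ => ∅, fun h => absurd h hx⟩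
  choose G hG using hG
  have hinter : ∀ x ∈ ρ, ∀ y ∈ ρ, x ≠ y → v i ≤ (G x i ∩ G y i).card := fun x hx y hy hxy =>
    le_card_inter_of_isCompatible hex hun hex' hv hvk hρ hx hy hxy (hG x hx) (hG y hy)
  have hGf : ∀ z ∈ f i, G z = eraseNode f z := fun z hz =>
    hun' _ hw hwk _ (hcard z (hf.subset i hz)) _ _ (hG z (hf.subset i hz)) (hf.eraseNode hz)
  -- If `u ∈ G x i` lay outside `f i`, then for `z` in both fibres the set `G x i ∩ (f i).erase z`
  -- would miss `u` and `z`, hence be too small.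
  have hsub : ∀ x ∈ ρ, x ∉ f i → G x i ⊆ f i := by
    intro x hx hxf u hu
    by_contra huf
    have hint : ∀ z ∈ f i, v i ≤ (G x i ∩ (f i).erase z).card := fun z hz => by
      have := hinter x hx z (hf.subset i hz) (fun e => hxf (e ▸ hz))
      rwa [hGf z hz] at this
    obtain ⟨z₀, hz₀⟩ : (f i).Nonempty := card_pos.1 (by omega)
    obtain ⟨z, hz⟩ : (G x i ∩ (f i).erase z₀).Nonempty :=
      card_pos.1 ((hv i).trans_le (hint z₀ hz₀))
    rw [mem_inter, mem_erase] at hz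
    have hle : G x i ∩ (f i).erase z ⊆ ((G x i).erase u).erase z := fun y hy => by
      rw [mem_inter, mem_erase] at hy
      exact mem_erase.2 ⟨hy.2.1, mem_erase.2 ⟨fun e => huf (e ▸ hy.2.2), hy.1⟩⟩
    have := card_le_card hle
    rw [card_erase_of_mem (mem_erase.2 ⟨fun e : z = u => huf (e ▸ hz.2.2), hz.1⟩), card_erase_of_mem hu,
      (hG x hx).card_eq, hwi] at this
    have := hint z hz.2.2
    have := hv i
    omega
  obtain ⟨x, hxl⟩ : (f l).Nonempty := card_pos.1 (by
    rw [hf.card_eq]; exact add_single_pos (add_single_pos hv i) i l)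
  have hxρ := hf.subset l hxl
  have hxi : x ∉ f i := fun h => hli (hf.unique hxl h)
  have hGx := hG x hxρ
  obtain ⟨y, hy⟩ : (G x l).Nonempty := card_pos.1 (by rw [hGx.card_eq]; exact hw l)
  have hyρx := hGx.subset l hy
  obtain ⟨hyx, hyρ⟩ := mem_erase.1 hyρx
  have hGy := hG y hyρ
  obtain ⟨a, ha⟩ : (G x i ∩ G y i).Nonempty :=
    card_pos.1 ((hv i).trans_le (hinter x hxρ y hyρ hyx.symm))
  obtain ⟨hax, hay⟩ := mem_inter.1 ha
  obtain ⟨hax', haρ⟩ := mem_erase.1 (hGx.subset i hax)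
  obtain ⟨hay', -⟩ := mem_erase.1 (hGy.subset i hay)
  have haf : a ∈ f i := hsub x hxρ hxi hax
  -- The tope of type `v + e_l` on `ρ.erase a` links `G x` and `G y`: its `l`-th fibre contains `x`
  -- and `y`, and removing `x` or `y` from it gives `G x` or `G y` without `a`.
  obtain ⟨h, hh⟩ := hex' (v + Pi.single l 1) (add_single_pos hv l) (by rw [sum_add_single, hvk])
    (ρ.erase a) (hcard a haρ)
  have hPx := hGx.eraseNode hax
  have hPy := hGy.eraseNode hay
  rw [erase_right_comm] at hPx hPy
  have hxh : x ∈ h l := by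
    obtain ⟨c, hc⟩ : ((f i).erase a).Nonempty :=
      card_pos.1 (by rw [card_erase_of_mem haf, hfi]; omega)
    have hc' : c ∈ eraseNode f a i := hc
    obtain ⟨p, -, hp⟩ := hh.exists_eq_erase hex hun hex' hv hvk (hcard a haρ)
      ((hf.eraseNode haf).subset i hc') ((hf.eraseNode haf).eraseNode hc')
    rw [(hf.eraseNode haf).eraseNode_apply_of_ne hc' hli, hf.eraseNode_apply_of_ne haf hli] at hp
    rw [hp] at hxl
    exact mem_of_mem_erase hxl
  have hyh : y ∈ h l := by
    obtain ⟨p, -, hp⟩ := hh.exists_eq_erase hex hun hex' hv hvk (hcard a haρ)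
      (mem_erase.2 ⟨hax'.symm, hxρ⟩) hPx
    rw [hGx.eraseNode_apply_of_ne hax hli] at hp
    rw [hp] at hy
    exact mem_of_mem_erase hy
  have e1 : eraseNode (G x) a = eraseNode h x :=
    hun v hv hvk _ (hcard2 a haρ x hxρ hax') _ _ hPx (hh.eraseNode hxh)
  have e2 : eraseNode (G y) a = eraseNode h y :=
    hun v hv hvk _ (hcard2 a haρ y hyρ hay') _ _ hPy (hh.eraseNode hyh)
  have hxG : x ∈ G y l := by
    have : x ∈ eraseNode (G y) a l := by rw [e2]; exact mem_eraseNode.2 ⟨hyx.symm, hxh⟩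
    exact (mem_eraseNode.1 this).2
  -- Both `G x` without `y` and `G y` without `x` are `h` without `x` and `y`, with `a` added in the
  -- fibre of `i`.
  obtain ⟨T, hT, -⟩ := hGx.glue hGy hy hxG (by
    rw [← hGx.insertNode_eraseNode hax, ← hGy.insertNode_eraseNode hay, e1, e2,
      eraseNode_insertNode_of_ne _ hay', eraseNode_insertNode_of_ne _ hax', eraseNode_comm])
  exact ⟨T, hT⟩

theorem HasTopes.succ_succ (hk : Fintype.card ι ≤ k) (hex : HasTopes 𝓜 k)
    (hun : TopesUnique 𝓜 k) (hex' : HasTopes 𝓜 (k + 1)) (hun' : TopesUnique 𝓜 (k + 1)) :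
    HasTopes 𝓜 (k + 2) := by
  intro w hw hwk ρ hρ
  obtain ⟨u, l, hu, rfl⟩ := exists_eq_add_single hw (by omega)
  have huk : ∑ k, u k = k + 1 := by rw [sum_add_single] at hwk; omega
  obtain ⟨v, i, hv, rfl⟩ := exists_eq_add_single hu (by omega)
  have hvk : ∑ k, v k = k := by rw [sum_add_single] at huk; omega
  by_cases hli : l = i
  · subst hli
    exact exists_isCompatible_add_single_add_single hex hun hex' hv hvk hρ
  · exact exists_isCompatible_add_single_add_single_of_ne hex hun hex' hun' hv hvk hρ hli

/-- The set of functions `𝓜` is a matching field with the linkage property; a function is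
identified with the matching that is its graph. -/
structure IsLinkageSystem (𝓜 : Set (ι → α)) : Prop where
  injective : ∀ s ∈ 𝓜, Function.Injective s
  unique : ∀ s ∈ 𝓜, ∀ s' ∈ 𝓜, univ.image s = univ.image s' → s = s'
  exists_image_eq : ∀ σ : Finset α, σ.card = Fintype.card ι → ∃ s ∈ 𝓜, univ.image s = σ
  linkage : ∀ (i : ι) (τ : Finset α), τ.card = Fintype.card ι + 1 →
    ∃ s ∈ 𝓜, ∃ s' ∈ 𝓜, univ.image s ⊆ τ ∧ univ.image s' ⊆ τ ∧ s ≠ s' ∧ ∀ k, k ≠ i → s k = s' k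

namespace IsLinkageSystem

theorem isCompatible_singleton (h𝓜 : IsLinkageSystem 𝓜) {s : ι → α} (hs : s ∈ 𝓜) :
    IsCompatible 𝓜 (fun _ => 1) (univ.image s) (fun i => {s i}) where
  card_eq _ := card_singleton _
  mem_iff x := by simp [eq_comm]
  unique x a b ha hb := by
    rw [mem_singleton] at ha hb
    exact h𝓜.injective s hs (ha.symm.trans hb)
  mem_of_transversal t ht := by
    have : t = s := funext fun i => mem_singleton.1 (ht i)
    rwa [this]

theorem hasTopes_card (h𝓜 : IsLinkageSystem 𝓜) : HasTopes 𝓜 (Fintype.card ι) := by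
  intro v hv hvk σ hσ
  obtain rfl := eq_one_of_sum_eq_card hv hvk
  obtain ⟨s, hs, rfl⟩ := h𝓜.exists_image_eq σ hσ
  exact ⟨_, h𝓜.isCompatible_singleton hs⟩

theorem topesUnique_card (h𝓜 : IsLinkageSystem 𝓜) : TopesUnique 𝓜 (Fintype.card ι) := by
  intro v hv hvk σ hσ T T' hT hT'
  obtain rfl := eq_one_of_sum_eq_card hv hvk
  choose s hs using fun i => card_eq_one.1 (hT.card_eq i)
  choose t ht using fun i => card_eq_one.1 (hT'.card_eq i)
  have key : ∀ {T : ι → Finset α} {s : ι → α}, IsCompatible 𝓜 (fun _ => 1) σ T →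
      (∀ i, T i = {s i}) → s ∈ 𝓜 ∧ univ.image s = σ := by
    intro T s hT hs
    refine ⟨hT.mem_of_transversal s fun i => by simp [hs], ?_⟩
    ext x
    rw [hT.mem_iff]
    simp [hs, eq_comm]
  obtain ⟨h1, h2⟩ := key hT hs
  obtain ⟨h3, h4⟩ := key hT' ht
  have := h𝓜.unique s h1 t h3 (h2.trans h4.symm)
  ext i : 1
  rw [hs, ht, this]

/-- The linkage axiom provides two matchings in `τ` that differ only at `i`, which is exactly the
situation for gluing. This is the only place where linkage enters. -/
theorem hasTopes_card_add_one (h𝓜 : IsLinkageSystem 𝓜) :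
    HasTopes 𝓜 (Fintype.card ι + 1) := by
  intro w hw hwk τ hτ
  obtain ⟨v, i, hv, rfl⟩ := exists_eq_add_single hw (by omega)
  obtain rfl := eq_one_of_sum_eq_card hv (by rw [sum_add_single] at hwk; omega)
  have aux : ∀ s ∈ 𝓜, ∀ s' ∈ 𝓜, univ.image s ⊆ τ → univ.image s' ⊆ τ → s ≠ s' →
      (∀ k, k ≠ i → s k = s' k) → (∀ k, s k ≠ s' i) ∧ univ.image s = τ.erase (s' i) := by
    intro s hs s' hs' hsτ hsτ' hne hoff
    have hni : ∀ k, s k ≠ s' i := by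
      intro k hk
      by_cases hki : k = i
      · subst hki
        refine hne (funext fun l => ?_)
        by_cases hl : l = k
        · rw [hl, hk]
        · exact hoff l hl
      · exact hki (h𝓜.injective s' hs' ((hoff k hki).symm.trans hk))
    refine ⟨hni, eq_of_subset_of_card_le (fun x hx => ?_) ?_⟩
    · refine mem_erase.2 ⟨?_, hsτ hx⟩
      obtain ⟨k, -, rfl⟩ := mem_image.1 hx
      exact hni k
    · rw [card_erase_of_mem (hsτ' (mem_image_of_mem s' (mem_univ i))), hτ,
        card_image_of_injective _ (h𝓜.injective s hs)]
      simp
  obtain ⟨s, hs, s', hs', hsτ, hsτ', hne, hoff⟩ := h𝓜.linkage i τ hτ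
  obtain ⟨hn1, h1⟩ := aux s hs s' hs' hsτ hsτ' hne hoff
  obtain ⟨hn2, h2⟩ := aux s' hs' s hs hsτ' hsτ hne.symm fun k hk => (hoff k hk).symm
  have hP := h𝓜.isCompatible_singleton hs
  have hQ := h𝓜.isCompatible_singleton hs'
  rw [h1] at hP
  rw [h2] at hQ
  obtain ⟨T, hT, -⟩ := hP.glue hQ (i := i) (mem_singleton_self _) (mem_singleton_self _) (by
    ext k x
    simp only [mem_eraseNode, mem_singleton]
    by_cases hk : k = i
    · subst hk; tauto
    · rw [hoff k hk]
      constructor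
      · rintro ⟨-, rfl⟩
        exact ⟨fun h => hk (h𝓜.injective s' hs' h), rfl⟩
      · rintro ⟨-, rfl⟩
        exact ⟨fun h => hn2 k h, rfl⟩)
  exact ⟨T, hT⟩

/-- Existence at thickness `k + 2` uses thicknesses `k` and `k + 1`, so the induction carries two
consecutive levels. -/
theorem hasTopes_and_topesUnique (h𝓜 : IsLinkageSystem 𝓜) (hk : Fintype.card ι ≤ k) :
    HasTopes 𝓜 k ∧ TopesUnique 𝓜 k := by
  have key : ∀ m, (HasTopes 𝓜 (Fintype.card ι + m) ∧ TopesUnique 𝓜 (Fintype.card ι + m)) ∧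
      HasTopes 𝓜 (Fintype.card ι + m + 1) ∧ TopesUnique 𝓜 (Fintype.card ι + m + 1) := by
    intro m
    induction m with
    | zero =>
      have h1 := h𝓜.hasTopes_card
      have h2 := h𝓜.topesUnique_card
      have h3 := h𝓜.hasTopes_card_add_one
      exact ⟨⟨h1, h2⟩, h3, h2.succ le_rfl h1 h3⟩
    | succ m ih =>
      obtain ⟨⟨h1, h2⟩, h3, h4⟩ := ih
      have h5 := HasTopes.succ_succ (Nat.le_add_right _ _) h1 h2 h3 h4
      exact ⟨⟨h3, h4⟩, h5, h4.succ (by omega) h3 h5⟩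
  obtain ⟨m, rfl⟩ := Nat.exists_eq_add_of_le hk
  exact (key m).1

end IsLinkageSystem

end Completeness

/-! ### Uniqueness of amalgamations -/

section Covectors

open Finset

variable {α ι : Type*} [DecidableEq α] [DecidableEq ι] [Fintype ι] {𝓜 : Set (ι → α)} {k : ℕ}

/-- The union of the topes of type `v` on the `k`-subsets of `τ` contains only one tope of type
`v + e_i`. -/
theorem IsCompatible.eq_of_subset_covector {v : ι → ℕ} {i : ι} {τ : Finset α}
    {T g : ι → Finset α} (hex : HasTopes 𝓜 k) (hun : TopesUnique 𝓜 k)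
    (hex' : HasTopes 𝓜 (k + 1)) (hv : ∀ i, 0 < v i) (hvk : ∑ i, v i = k)
    (hτ : τ.card = k + 1) (hT : IsCompatible 𝓜 (v + Pi.single i 1) τ T)
    (hcard : ∀ l, (g l).card = (v + Pi.single i 1 : ι → ℕ) l)
    (huniq : ∀ x l l', x ∈ g l → x ∈ g l' → l = l')
    (hg : ∀ l, ∀ x ∈ g l, ∃ σ ⊆ τ, σ.card = k ∧ ∃ P, IsCompatible 𝓜 v σ P ∧ x ∈ P l) :
    g = T := by
  have hsplit : ∀ σ ⊆ τ, σ.card = k → ∃ j ∈ τ, σ = τ.erase j := by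
    intro σ hσ hc
    obtain ⟨a, ha, rfl⟩ := exists_eq_insert_iff.2 ⟨hσ, by rw [hc, hτ]⟩
    exact ⟨a, mem_insert_self _ _, (erase_insert ha).symm⟩
  have hgτ : ∀ l, g l ⊆ τ := fun l x hx => by
    obtain ⟨σ, hσ, -, P, hP, hxP⟩ := hg l x hx
    exact hσ (hP.subset l hxP)
  have hE : ∀ l, ∃ E, IsCompatible 𝓜 (v + Pi.single l 1) τ E ∧ (l = i → E = T) := fun l => by
    by_cases hl : l = i
    · subst hl; exact ⟨T, hT, fun _ => rfl⟩
    · obtain ⟨E, hE⟩ := hex' (v + Pi.single l 1) (add_single_pos hv l)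
        (by rw [sum_add_single, hvk]) τ hτ
      exact ⟨E, hE, fun h => absurd h hl⟩
  choose E hE hET using hE
  have hEcard : ∀ l, (E l l).card = v l + 1 := fun l => by rw [(hE l).card_eq]; simp
  -- The union of the topes of type `v` thus has its `l`-th fibre inside `E l l`, which has only `v
  -- l + 1` elements.
  have hP : ∀ l σ P, σ ⊆ τ → σ.card = k → IsCompatible 𝓜 v σ P → P l ⊆ E l l := by
    intro l σ P hσ hc hP
    obtain ⟨j, hj, rfl⟩ := hsplit σ hσ hc
    obtain ⟨x, -, hx⟩ := (hE l).exists_eq_erase hex hun hex' hv hvk hτ hj hP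
    rw [hx]
    exact erase_subset _ _
  have hgE : ∀ l, g l ⊆ E l l := fun l x hx => by
    obtain ⟨σ, hσ, hc, P, hPσ, hxP⟩ := hg l x hx
    exact hP l σ P hσ hc hPσ hxP
  have hgi : g i = T i := by
    have h := hgE i
    rw [hET i rfl] at h
    exact eq_of_subset_of_card_le h (by rw [hT.card_eq, hcard])
  have hTE : ∀ l, l ≠ i → T l ⊆ E l l := fun l hl => by
    obtain ⟨j, hj⟩ : (T i).Nonempty :=
      card_pos.1 (by rw [hT.card_eq]; exact add_single_pos hv i i)
    have := hP l _ _ (erase_subset _ _)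
      (by rw [card_erase_of_mem (hT.subset i hj), hτ]; rfl) (hT.eraseNode hj)
    rwa [hT.eraseNode_apply_of_ne hj hl] at this
  by_contra hne
  obtain ⟨l₀, hl₀⟩ : ∃ l, g l ≠ T l := by
    by_contra! hc
    exact hne (funext hc)
  let D : Finset ι := univ.filter fun l => g l ≠ T l
  have hD : ∀ l ∈ D, l ≠ i ∧ g l ≠ T l := fun l hl =>
    ⟨fun e => (mem_filter.1 hl).2 (e ▸ hgi), (mem_filter.1 hl).2⟩
  have hTl : ∀ l ∈ D, (T l).card = v l := fun l hl => by
    rw [hT.card_eq]; simp [(hD l hl).1]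
  have hgW : ∀ l ∈ D, g l ⊆ D.biUnion T := by
    intro l hl x hx
    obtain ⟨l', hl'⟩ := (hT.mem_iff x).1 (hgτ l hx)
    refine mem_biUnion.2 ⟨l', ?_, hl'⟩
    by_contra hlD
    have : g l' = T l' := by simpa [D] using hlD
    exact hlD (huniq x l l' hx (this ▸ hl') ▸ hl)
  -- For `l ∈ D` the sets `T l` and `g l` are distinct of size `v l` inside a set of size `v l + 1`,
  -- so they cover it.
  have hEW : ∀ l ∈ D, E l l ⊆ D.biUnion T := by
    intro l hl
    have h1 : T l ∪ g l = E l l := by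
      refine eq_of_subset_of_card_le (union_subset (hTE l (hD l hl).1) (hgE l)) ?_
      by_contra! hlt
      rw [hEcard] at hlt
      have hle : (T l ∪ g l).card ≤ (T l).card := by rw [hTl l hl]; omega
      have h2 := eq_of_subset_of_card_le (subset_union_left (s₁ := T l) (s₂ := g l)) hle
      have h3 : g l ⊆ T l := by rw [h2]; exact subset_union_right
      exact (hD l hl).2 (eq_of_subset_of_card_le h3 (by rw [hT.card_eq, hcard]))
    rw [← h1]
    exact union_subset (subset_biUnion_of_mem T hl) (hgW l hl)
  have hl₀D : l₀ ∈ D := mem_filter.2 ⟨mem_univ _, hl₀⟩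
  obtain ⟨x, hx⟩ : (T l₀).Nonempty := card_pos.1 (by rw [hTl l₀ hl₀D]; exact hv l₀)
  have hxτ := hT.subset _ hx
  have hc : (τ.erase x).card = k := by rw [card_erase_of_mem hxτ, hτ]; rfl
  obtain ⟨P, hPx⟩ := hex v hv hvk _ hc
  -- The left side has one element more than the right side: both unions are disjoint with total
  -- size `∑ l ∈ D, v l`, and `P` avoids `x`.
  have hsub : insert x (D.biUnion P) ⊆ D.biUnion T := by
    refine insert_subset (mem_biUnion.2 ⟨l₀, hl₀D, hx⟩) (biUnion_subset.2 fun l hl => ?_)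
    exact (hP l _ _ (erase_subset _ _) hc hPx).trans (hEW l hl)
  have := card_le_card hsub
  rw [card_insert_of_notMem, card_biUnion, card_biUnion, sum_congr rfl hTl,
    sum_congr rfl fun l _ => hPx.card_eq l] at this
  · omega
  · exact fun a _ b _ hab => disjoint_left.2 fun y ha hb => hab (hT.unique ha hb)
  · exact fun a _ b _ hab => disjoint_left.2 fun y ha hb => hab (hPx.unique ha hb)
  · intro h
    obtain ⟨l, -, hl⟩ := mem_biUnion.1 h
    simpa using hPx.subset l hl

end Covectors

/-! ### Bipartite graphs as families of fibres -/

namespace BipGraph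

open Finset

variable {n d : ℕ}

/-- The neighbours of a right node. -/
def fibre (T : BipGraph n d) (i : Fin d) : Finset (Fin n) := univ.filter fun x => (x, i) ∈ T

/-- The bipartite graph with given neighbourhoods of the right nodes. -/
def ofFibres (T : Fin d → Finset (Fin n)) : BipGraph n d := univ.filter fun e => e.1 ∈ T e.2

@[simp] theorem mem_fibre {T : BipGraph n d} {i : Fin d} {x : Fin n} :
    x ∈ T.fibre i ↔ (x, i) ∈ T := by simp [fibre]

@[simp] theorem mem_ofFibres {T : Fin d → Finset (Fin n)} {i : Fin d} {x : Fin n} :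
    (x, i) ∈ ofFibres T ↔ x ∈ T i := by simp [ofFibres]

@[simp] theorem fibre_ofFibres (T : Fin d → Finset (Fin n)) : (ofFibres T).fibre = T := by
  ext i x; simp

@[simp] theorem ofFibres_fibre (T : BipGraph n d) : ofFibres T.fibre = T := by
  ext ⟨x, i⟩; simp

theorem subset_iff_fibre {T T' : BipGraph n d} : T ⊆ T' ↔ ∀ i, T.fibre i ⊆ T'.fibre i := by
  constructor
  · intro h i x hx
    exact mem_fibre.2 (h (mem_fibre.1 hx))
  · rintro h ⟨x, i⟩ hx
    exact mem_fibre.1 (h i (mem_fibre.2 hx))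

theorem card_fibre (T : BipGraph n d) (i : Fin d) : (T.fibre i).card = T.rightDegree i := by
  rw [rightDegree]
  refine card_bij (fun x _ => (x, i)) ?_ ?_ ?_
  · intro x hx; simpa using hx
  · intro x _ y _ h; exact (Prod.ext_iff.1 h).1
  · rintro ⟨x, l⟩ h
    simp only [mem_filter] at h
    obtain ⟨h, rfl⟩ := h
    exact ⟨x, by simpa using h, rfl⟩

namespace IsTope

variable {v : Fin d → ℕ} {σ : Finset (Fin n)} {T : BipGraph n d}

theorem card_fibre (h : T.IsTope v σ) (i : Fin d) : (T.fibre i).card = v i := by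
  rw [BipGraph.card_fibre, h.1]

theorem eq_of_mem (h : T.IsTope v σ) {x : Fin n} {i l : Fin d} (hi : (x, i) ∈ T)
    (hl : (x, l) ∈ T) : i = l := by
  have h1 : T.leftDegree x ≤ 1 := by rw [h.2]; split_ifs <;> simp
  have := card_le_one.1 h1 (x, i) (by simp [hi]) (x, l) (by simp [hl])
  exact (Prod.ext_iff.1 this).2

theorem mem_iff (h : T.IsTope v σ) (x : Fin n) : x ∈ σ ↔ ∃ i, (x, i) ∈ T := by
  have hx := h.2 x
  constructor
  · intro hσ
    rw [if_pos hσ] at hx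
    obtain ⟨⟨y, i⟩, hy⟩ := card_pos.1 (by rw [← leftDegree, hx]; exact one_pos)
    simp only [mem_filter] at hy
    obtain ⟨hy, rfl⟩ := hy
    exact ⟨i, hy⟩
  · rintro ⟨i, hi⟩
    by_contra hσ
    rw [if_neg hσ, leftDegree, card_eq_zero] at hx
    have : (x, i) ∈ T.filter fun e => e.1 = x := by simp [hi]
    rw [hx] at this
    simp at this

theorem isCompatible (h : T.IsTope v σ) {𝓜 : Set (Fin d → Fin n)}
    (h𝓜 : ∀ s : Fin d → Fin n, (∀ i, (s i, i) ∈ T) → s ∈ 𝓜) : IsCompatible 𝓜 v σ T.fibre where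
  card_eq := h.card_fibre
  mem_iff x := by simpa using h.mem_iff x
  unique x i l hi hl := h.eq_of_mem (mem_fibre.1 hi) (mem_fibre.1 hl)
  mem_of_transversal s hs := h𝓜 s fun i => mem_fibre.1 (hs i)

end IsTope

end BipGraph

theorem IsCompatible.isTope {n d : ℕ} {𝓜 : Set (Fin d → Fin n)} {v : Fin d → ℕ}
    {σ : Finset (Fin n)} {T : Fin d → Finset (Fin n)} (h : IsCompatible 𝓜 v σ T) :
    (BipGraph.ofFibres T).IsTope v σ := by
  refine ⟨fun i => by rw [← BipGraph.card_fibre]; simp [h.card_eq], fun x => ?_⟩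
  rw [BipGraph.leftDegree]
  split_ifs with hx
  · obtain ⟨i, hi⟩ := (h.mem_iff x).1 hx
    rw [Finset.card_eq_one]
    refine ⟨(x, i), ?_⟩
    ext ⟨y, l⟩
    simp only [Finset.mem_filter, BipGraph.mem_ofFibres, Finset.mem_singleton, Prod.mk.injEq]
    constructor
    · rintro ⟨hy, rfl⟩
      exact ⟨rfl, h.unique hy hi⟩
    · rintro ⟨rfl, rfl⟩
      exact ⟨hi, rfl⟩
  · rw [Finset.card_eq_zero, Finset.eq_empty_iff_forall_notMem]
    rintro ⟨y, l⟩ hy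
    simp only [Finset.mem_filter, BipGraph.mem_ofFibres] at hy
    obtain ⟨hy, rfl⟩ := hy
    exact hx ((h.mem_iff y).2 ⟨l, hy⟩)

/-! ### Matchings as functions, and the derived tope fields -/

namespace MatchingField

open Finset

variable {n d : ℕ}

/-- The matchings of `M` as functions from the right to the left nodes. -/
def functions (M : MatchingField n d) : Set (Fin d → Fin n) :=
  {s | ∃ σ, ∀ i, (s i, i) ∈ M.tope σ}

theorem exists_forall_mem (M : MatchingField n d) (σ : KSubset n d) :
    ∃ s : Fin d → Fin n, ∀ i, (s i, i) ∈ M.tope σ := by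
  choose s hs using fun i => card_eq_one.1 ((M.isTope σ).card_fibre i)
  exact ⟨s, fun i => BipGraph.mem_fibre.1 (by simp [hs])⟩

/-- The function whose graph is the matching on `σ`. -/
noncomputable def function (M : MatchingField n d) (σ : KSubset n d) : Fin d → Fin n :=
  (M.exists_forall_mem σ).choose

theorem function_mem (M : MatchingField n d) (σ : KSubset n d) (i : Fin d) :
    (M.function σ i, i) ∈ M.tope σ := (M.exists_forall_mem σ).choose_spec i

theorem mem_tope_iff (M : MatchingField n d) {σ : KSubset n d} {x : Fin n} {i : Fin d} :
    (x, i) ∈ M.tope σ ↔ x = M.function σ i := by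
  constructor
  · intro h
    exact card_le_one.1 ((M.isTope σ).card_fibre i).le x (BipGraph.mem_fibre.2 h) _
      (BipGraph.mem_fibre.2 (M.function_mem σ i))
  · rintro rfl
    exact M.function_mem σ i

theorem function_mem_functions (M : MatchingField n d) (σ : KSubset n d) :
    M.function σ ∈ M.functions := ⟨σ, M.function_mem σ⟩

theorem mem_functions_iff (M : MatchingField n d) {s : Fin d → Fin n} :
    s ∈ M.functions ↔ ∃ σ, M.function σ = s := by
  constructor
  · rintro ⟨σ, h⟩
    exact ⟨σ, funext fun i => (M.mem_tope_iff.1 (h i)).symm⟩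
  · rintro ⟨σ, rfl⟩
    exact M.function_mem_functions σ

theorem function_apply_injective (M : MatchingField n d) (σ : KSubset n d) :
    Function.Injective (M.function σ) := fun i l h =>
  (M.isTope σ).eq_of_mem (M.function_mem σ i) (by rw [h]; exact M.function_mem σ l)

theorem image_function (M : MatchingField n d) (σ : KSubset n d) :
    univ.image (M.function σ) = σ.1 := by
  ext x
  rw [(M.isTope σ).mem_iff]
  simp [mem_tope_iff, eq_comm]

theorem function_injective (M : MatchingField n d) : Function.Injective M.function :=
  fun σ σ' h => Subtype.ext (by rw [← M.image_function σ, h, M.image_function])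

theorem IsLinkage.isLinkageSystem {M : MatchingField n d} (hM : M.IsLinkage) :
    IsLinkageSystem M.functions where
  injective s hs := by
    obtain ⟨σ, rfl⟩ := M.mem_functions_iff.1 hs
    exact M.function_apply_injective σ
  unique s hs s' hs' h := by
    obtain ⟨σ, rfl⟩ := M.mem_functions_iff.1 hs
    obtain ⟨σ', rfl⟩ := M.mem_functions_iff.1 hs'
    rw [M.image_function, M.image_function] at h
    rw [Subtype.ext h]
  exists_image_eq σ hσ :=
    ⟨_, M.function_mem_functions ⟨σ, by simpa using hσ⟩, M.image_function _⟩
  linkage i τ hτ := by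
    obtain ⟨j, hj, j', hj', hne, h⟩ := hM i ⟨τ, by simpa using hτ⟩
    refine ⟨_, M.function_mem_functions _, _, M.function_mem_functions _,
      (M.image_function (KSubset.remove _ j hj)).trans_subset (erase_subset _ _),
      (M.image_function (KSubset.remove _ j' hj')).trans_subset (erase_subset _ _), ?_, ?_⟩
    · intro e
      have := congrArg Subtype.val (M.function_injective e)
      have hjj : j ∈ τ.erase j' := mem_erase.2 ⟨hne, hj⟩
      change τ.erase j = τ.erase j' at this
      rw [← this] at hjj
      simp at hjj
    · intro l hl
      rw [← M.mem_tope_iff]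
      exact (h _ hl).1 (M.function_mem _ l)

theorem _root_.TopeField.le_thickness {k : ℕ} {v : Fin d → ℕ} (F : TopeField n d k v) :
    d ≤ k := by
  have := Finset.sum_le_sum fun i (_ : i ∈ univ) => Nat.succ_le_of_lt (F.type_pos i)
  simpa [F.sum_type] using this

/-- By induction the union being amalgamated consists of compatible topes, and the only tope of the
new type inside it is the compatible one. -/
theorem Derives.isCompatible {M : MatchingField n d} (hM : M.IsLinkage) {k : ℕ}
    {v : Fin d → ℕ} {F : TopeField n d k v} (hF : M.Derives F) (σ : KSubset n k) :
    IsCompatible M.functions v σ.1 (F.tope σ).fibre := by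
  induction hF with
  | base => exact (M.isTope σ).isCompatible fun s hs => ⟨σ, hs⟩
  | @step k v F i G hF hG ih =>
    have hk : Fintype.card (Fin d) ≤ k := by simpa using F.le_thickness
    obtain ⟨hex, hun⟩ := hM.isLinkageSystem.hasTopes_and_topesUnique hk
    obtain ⟨hex', -⟩ := hM.isLinkageSystem.hasTopes_and_topesUnique (Nat.le_succ_of_le hk)
    obtain ⟨T, hT⟩ := hex' _ G.type_pos G.sum_type σ.1 σ.2
    rw [hT.eq_of_subset_covector (g := (G.tope σ).fibre) hex hun hex' F.type_pos F.sum_type σ.2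
      (G.isTope σ).card_fibre
      (fun x l l' h h' => (G.isTope σ).eq_of_mem (BipGraph.mem_fibre.1 h) (BipGraph.mem_fibre.1 h'))
      fun l x hx => ?_]
    · exact hT
    · have := hG σ (BipGraph.mem_fibre.1 hx)
      simp only [TopeField.covector, mem_biUnion, mem_filter, mem_univ, true_and] at this
      obtain ⟨σ', hσ', hx'⟩ := this
      exact ⟨σ'.1, hσ', σ'.2, _, ih σ', BipGraph.mem_fibre.2 hx'⟩

theorem IsLinkage.exists_derives {M : MatchingField n d} (hM : M.IsLinkage) {k : ℕ}
    (hk : d ≤ k) : k ≤ n → ∀ v : Fin d → ℕ, (∀ i, 0 < v i) → ∑ i, v i = k →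
      ∃ F : TopeField n d k v, M.Derives F := by
  induction k, hk using Nat.le_induction with
  | base =>
    intro _ v hv hvk
    obtain rfl := eq_one_of_sum_eq_card hv (by simpa using hvk)
    exact ⟨M, Derives.base⟩
  | succ k hk ih =>
    intro hkn w hw hwk
    obtain ⟨v, i, hv, rfl⟩ := exists_eq_add_single hw (by simp; omega)
    have hvk : ∑ k, v k = k := by rw [sum_add_single] at hwk; omega
    obtain ⟨F, hF⟩ := ih (by omega) v hv hvk
    have hk' : Fintype.card (Fin d) ≤ k := by simpa using hk
    obtain ⟨-, hun⟩ := hM.isLinkageSystem.hasTopes_and_topesUnique hk'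
    obtain ⟨hex', -⟩ := hM.isLinkageSystem.hasTopes_and_topesUnique (Nat.le_succ_of_le hk')
    choose T hT using fun τ : KSubset n (k + 1) => hex' _ hw hwk τ.1 τ.2
    refine ⟨⟨hw, hwk, hkn, fun τ => BipGraph.ofFibres (T τ), fun τ => (hT τ).isTope⟩,
      Derives.step i _ hF ?_⟩
    rintro τ ⟨x, l⟩ hx
    have hx : x ∈ T τ l := BipGraph.mem_ofFibres.1 hx
    -- The fibre of `i` has at least two nodes, so some `j` other than `x` can be removed. What
    -- remains is the tope of `F` on `τ` without `j`, and it still has the edge at `x`.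
    obtain ⟨j, hj, hjx⟩ : ∃ j ∈ T τ i, j ≠ x := by
      refine exists_mem_ne ?_ x
      have := hv i
      rw [(hT τ).card_eq]
      simp only [Pi.add_apply, Pi.single_eq_same]
      omega
    have hjτ := (hT τ).subset i hj
    have := hun v hv hvk _ (τ.remove j hjτ).2 _ _ ((hT τ).eraseNode hj)
      (hF.isCompatible hM (τ.remove j hjτ))
    simp only [TopeField.covector, mem_biUnion, mem_filter, mem_univ, true_and]
    refine ⟨τ.remove j hjτ, erase_subset _ _, BipGraph.mem_fibre.1 ?_⟩
    rw [← this]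
    exact mem_eraseNode.2 ⟨hjx.symm, hx⟩

end MatchingField

/-! ### Induced embeddings of Hamming graphs -/

section Hamming

open Finset

theorem hammingDist_eq_one_iff {ι : Type*} {β : ι → Type*} [Fintype ι]
    [∀ i, DecidableEq (β i)] {p q : ∀ i, β i} :
    hammingDist p q = 1 ↔ p ≠ q ∧ ∃ i, ∀ k, k ≠ i → p k = q k := by
  constructor
  · intro h
    refine ⟨fun e => by simp [e] at h, ?_⟩
    obtain ⟨i, hi⟩ := card_eq_one.1 h
    refine ⟨i, fun k hk => ?_⟩
    by_contra hne
    have : k ∈ ({i} : Finset ι) := hi ▸ mem_filter.2 ⟨mem_univ k, hne⟩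
    exact hk (mem_singleton.1 this)
  · rintro ⟨hne, i, hi⟩
    refine card_eq_one.2 ⟨i, ?_⟩
    have hsub : ∀ k, p k ≠ q k → k = i := fun k hk => by_contra fun h => hk (hi k h)
    ext k
    simp only [mem_filter, mem_univ, true_and, mem_singleton]
    refine ⟨hsub k, ?_⟩
    rintro rfl
    intro h
    refine hne (funext fun l => ?_)
    by_cases hl : l = k
    · rw [hl, h]
    · exact hi l hl

variable {ι α κ : Type*} {β : κ → Type*} [DecidableEq κ]

/-- A property of the points of a finite product that is stable under changing one coordinate
holds everywhere if it holds somewhere. -/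
theorem forall_of_update [Fintype κ] {P : (∀ t, β t) → Prop} (x : ∀ t, β t) (hx : P x)
    (h : ∀ x t c, P x → P (Function.update x t c)) (y : ∀ t, β t) : P y := by
  have key : ∀ s : Finset κ, P (s.piecewise y x) := by
    intro s
    induction s using Finset.induction_on with
    | empty => simpa using hx
    | insert t s _ ih =>
      rw [Finset.piecewise_insert]
      exact h _ _ _ ih
  simpa using key univ

variable [Fintype ι] [Fintype κ] [∀ t, DecidableEq (β t)] [DecidableEq α]

/-- In a Hamming graph, an edge of a complete graph on three vertices determines its
direction. -/
theorem direction_eq_of_triangle {p q r : ι → α} {i j l : ι} (hpq : p ≠ q) (hqr : q ≠ r)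
    (h1 : ∀ k, k ≠ i → p k = q k) (h2 : ∀ k, k ≠ j → q k = r k)
    (h3 : ∀ k, k ≠ l → p k = r k) : i = j := by
  have hi : p i ≠ q i := fun h => hpq (funext fun k => by
    by_cases hk : k = i
    · rw [hk, h]
    · exact h1 k hk)
  have hj : q j ≠ r j := fun h => hqr (funext fun k => by
    by_cases hk : k = j
    · rw [hk, h]
    · exact h2 k hk)
  by_contra hij
  have e1 : i = l := by
    by_contra hil
    exact hi ((h3 i hil).trans (h2 i hij).symm)
  have e2 : j = l := by
    by_contra hjl
    exact hj ((h1 j (Ne.symm hij)).symm.trans (h3 j hjl))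
  exact hij (e1.trans e2.symm)

variable {ψ : (∀ t, β t) → ι → α}

/-- The points of a line are pairwise adjacent, and all edges of a triangle have the same direction.
-/
theorem exists_direction [Nonempty ι] (hψ : Function.Injective ψ)
    (h : ∀ x y, hammingDist (ψ x) (ψ y) = 1 ↔ hammingDist x y = 1) (x : ∀ t, β t) (t : κ) :
    ∃ i, ∀ c c', ∀ k, k ≠ i →
      ψ (Function.update x t c) k = ψ (Function.update x t c') k := by
  have hadj : ∀ c c', c ≠ c' → ∃ i, ∀ k, k ≠ i →
      ψ (Function.update x t c) k = ψ (Function.update x t c') k := fun c c' hc => by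
    refine (hammingDist_eq_one_iff.1 ((h _ _).2 (hammingDist_eq_one_iff.2 ⟨?_, t, ?_⟩))).2
    · exact fun e => hc (Function.update_injective x t e)
    · intro k hk
      simp [hk]
  have hne : ∀ c c', c ≠ c' → ψ (Function.update x t c) ≠ ψ (Function.update x t c') :=
    fun c c' hc e => hc (Function.update_injective x t (hψ e))
  by_cases hs : ∃ c c' : β t, c ≠ c'
  · obtain ⟨a, b, hab⟩ := hs
    obtain ⟨i, hi⟩ := hadj a b hab
    have step : ∀ c, ∀ k, k ≠ i →
        ψ (Function.update x t a) k = ψ (Function.update x t c) k := by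
      intro c k hk
      by_cases hca : a = c
      · rw [hca]
      by_cases hcb : b = c
      · rw [← hcb]; exact hi k hk
      · obtain ⟨j, hj⟩ := hadj b c hcb
        obtain ⟨l, hl⟩ := hadj a c hca
        have := direction_eq_of_triangle (hne _ _ hab) (hne _ _ hcb) hi hj hl
        subst this
        exact (hi k hk).trans (hj k hk)
    exact ⟨i, fun c c' k hk => (step c k hk).symm.trans (step c' k hk)⟩
  · push Not at hs
    -- A factor with a single point has no edges, so any direction will do.
    exact ⟨Classical.arbitrary ι, fun c c' k _ => by rw [hs c c']⟩

/-- Parallel lines have the same direction: opposite sides of a square change the same coordinate,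
because the embedding is induced and the square has no diagonals. -/
theorem direction_update (hψ : Function.Injective ψ)
    (h : ∀ x y, hammingDist (ψ x) (ψ y) = 1 ↔ hammingDist x y = 1) {x : ∀ t, β t} {t : κ} {i : ι}
    (hi : ∀ c c', ∀ k, k ≠ i → ψ (Function.update x t c) k = ψ (Function.update x t c') k)
    (s : κ) (b : β s) (c c' : β t) (k : ι) (hk : k ≠ i) :
    ψ (Function.update (Function.update x s b) t c) k =
      ψ (Function.update (Function.update x s b) t c') k := by
  by_cases hst : s = t
  · subst hst
    simpa using hi c c' k hk
  by_cases hc : c = c'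
  · rw [hc]
  by_cases hb : b = x s
  · rw [hb, Function.update_eq_self]
    exact hi c c' k hk
  have side : ∀ c, ∃ j, ∀ k, k ≠ j →
      ψ (Function.update x t c) k = ψ (Function.update (Function.update x s b) t c) k := by
    intro c
    refine (hammingDist_eq_one_iff.1 ((h _ _).2 (hammingDist_eq_one_iff.2 ⟨?_, s, ?_⟩))).2
    · intro e
      have := congrFun e s
      simp only [Function.update_of_ne hst, Function.update_self] at this
      exact hb this.symm
    · intro k hk
      by_cases hkt : k = t
      · subst hkt; simp
      · simp [hkt, hk]
  obtain ⟨i', hi'⟩ : ∃ i', ∀ k, k ≠ i' →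
      ψ (Function.update (Function.update x s b) t c) k =
        ψ (Function.update (Function.update x s b) t c') k := by
    refine (hammingDist_eq_one_iff.1 ((h _ _).2 (hammingDist_eq_one_iff.2 ⟨?_, t, ?_⟩))).2
    · exact fun e => hc (Function.update_injective _ t e)
    · intro k hk
      simp [hk]
  have diag : ∀ c c', c ≠ c' → ¬ ∃ j, ∀ k, k ≠ j →
      ψ (Function.update x t c) k = ψ (Function.update (Function.update x s b) t c') k := by
    intro c c' hc hj
    have hd := (h _ _).1 (hammingDist_eq_one_iff.2 ⟨fun e => ?_, hj⟩)
    · obtain ⟨-, l, hl⟩ := hammingDist_eq_one_iff.1 hd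
      have h1 : s = l := by
        by_contra hsl
        have := hl s hsl
        simp only [Function.update_of_ne hst, Function.update_self] at this
        exact hb this.symm
      have h2 : t = l := by
        by_contra htl
        have := hl t htl
        simp only [Function.update_self] at this
        exact hc this
      exact hst (h1.trans h2.symm)
    · have := congrFun (hψ e) t
      simp only [Function.update_self] at this
      exact hc this
  obtain ⟨j, hj⟩ := side c
  obtain ⟨j', hj'⟩ := side c'
  have hij' : i ≠ j' := by
    rintro rfl
    exact diag c c' hc ⟨i, fun k hk => (hi c c' k hk).trans (hj' k hk)⟩
  have hij : i ≠ j := by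
    rintro rfl
    exact diag c' c (Ne.symm hc) ⟨i, fun k hk => (hi c' c k hk).trans (hj k hk)⟩
  have hii' : i = i' := by
    by_contra hii'
    have e : ψ (Function.update x t c) i = ψ (Function.update x t c') i :=
      (hj i hij).trans ((hi' i hii').trans (hj' i hij').symm)
    refine hc (Function.update_injective x t (hψ (funext fun k => ?_)))
    by_cases hk : k = i
    · rw [hk, e]
    · exact hi c c' k hk
  subst hii'
  exact hi' k hk

/-- The image of an embedding of one Hamming graph as an induced subgraph of another one is a
product of sets. -/
theorem exists_eq_of_hammingDist_embedding [Nonempty ι] (hψ : Function.Injective ψ)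
    (h : ∀ x y, hammingDist (ψ x) (ψ y) = 1 ↔ hammingDist x y = 1) (p : ι → α)
    (hp : ∀ i, ∃ x, ψ x i = p i) : ∃ x, ψ x = p := by
  obtain ⟨x₀, -⟩ := hp (Classical.arbitrary ι)
  choose l hl using exists_direction hψ h x₀
  have hdir : ∀ t, ∀ x : ∀ t, β t, ∀ c c', ∀ k, k ≠ l t →
      ψ (Function.update x t c) k = ψ (Function.update x t c') k := fun t x =>
    forall_of_update (P := fun x => ∀ c c', ∀ k, k ≠ l t →
      ψ (Function.update x t c) k = ψ (Function.update x t c') k) x₀ (hl t)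
      (fun x s b hx c c' k hk => direction_update hψ h hx s b c c' k hk) x
  -- Each factor `t` influences only the coordinate `l t`, so distinct coordinates depend on
  -- disjoint sets of factors and can be prescribed independently.
  have hdep : ∀ i, ∀ x y : ∀ t, β t, (∀ t, l t = i → x t = y t) → ψ x i = ψ y i := by
    intro i x y hxy
    have key : ∀ s : Finset κ, ψ (s.piecewise y x) i = ψ x i := by
      intro s
      induction s using Finset.induction_on with
      | empty => simp
      | insert t s hts ih =>
        rw [Finset.piecewise_insert, ← ih]
        by_cases hti : l t = i
        · rw [← hxy t hti]
          congr 1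
          have : x t = s.piecewise y x t := by simp [hts]
          rw [this, Function.update_eq_self]
        · have := hdir t (s.piecewise y x) (y t) (s.piecewise y x t) i (Ne.symm hti)
          rwa [Function.update_eq_self] at this
    simpa using (key univ).symm
  choose x hx using hp
  refine ⟨fun t => x (l t) t, funext fun i => ?_⟩
  rw [← hx i]
  refine hdep i _ _ fun t ht => ?_
  rw [ht]

end Hamming

/-! ### Derived topes and cells as products of fibres -/

namespace MatchingField

open Finset

variable {n d : ℕ}

/-- All choices of one element from each of the nonempty sets `T i` are matchings of `M`. -/
def IsProduct (M : MatchingField n d) (T : Fin d → Finset (Fin n)) : Prop :=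
  (∀ i, (T i).Nonempty) ∧ ∀ s : Fin d → Fin n, (∀ i, s i ∈ T i) → s ∈ M.functions

/-- Disjointness of the fibres is automatic: a node in two fibres would give a transversal that is
not injective. -/
theorem IsProduct.isCompatible {M : MatchingField n d} {T : Fin d → Finset (Fin n)}
    (hT : M.IsProduct T) :
    IsCompatible M.functions (fun i => (T i).card) (univ.biUnion T) T where
  card_eq _ := rfl
  mem_iff x := by simp
  unique x i l hi hl := by
    choose s hs using hT.1
    by_contra hil
    have hmem := hT.2 (Function.update (Function.update s i x) l x) fun k => by
      by_cases hkl : k = l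
      · subst hkl; simpa using hl
      · by_cases hki : k = i
        · subst hki; simpa [hkl] using hi
        · simpa [hkl, hki] using hs k
    obtain ⟨σ, hσ⟩ := M.mem_functions_iff.1 hmem
    refine hil (M.function_apply_injective σ ?_)
    rw [hσ]
    simp [Function.update_of_ne hil]
  mem_of_transversal := hT.2

theorem IsProduct.sum_card_eq {M : MatchingField n d} {T : Fin d → Finset (Fin n)} (hT : M.IsProduct T) :
    ∑ i, (T i).card = (univ.biUnion T).card :=
  (card_biUnion fun _ _ _ _ hab =>
    disjoint_left.2 fun _ ha hb => hab (hT.isCompatible.unique ha hb)).symm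

theorem IsProduct.le_card_biUnion {M : MatchingField n d} {T : Fin d → Finset (Fin n)} (hT : M.IsProduct T) :
    d ≤ (univ.biUnion T).card := by
  rw [← hT.sum_card_eq]
  have := Finset.sum_le_sum fun i (_ : i ∈ univ) => Nat.succ_le_of_lt (card_pos.2 (hT.1 i))
  simpa using this

/-- A product is compatible for its own degree vector, and by uniqueness it is the member of the
derived field of that type. -/
theorem mem_derivedTopes_iff {M : MatchingField n d} (hM : M.IsLinkage) {T : BipGraph n d} :
    (∃ (k : ℕ) (v : Fin d → ℕ) (F : TopeField n d k v),
      M.Derives F ∧ ∃ σ : KSubset n k, F.tope σ = T) ↔ M.IsProduct T.fibre := by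
  constructor
  · rintro ⟨k, v, F, hF, σ, rfl⟩
    have h := hF.isCompatible hM σ
    exact ⟨fun i => card_pos.1 (by rw [h.card_eq]; exact F.type_pos i), h.mem_of_transversal⟩
  · intro hT
    have h := hT.isCompatible
    have hpos : ∀ i, 0 < (T.fibre i).card := fun i => card_pos.2 (hT.1 i)
    have hsum := hT.sum_card_eq
    have hd := hT.le_card_biUnion
    obtain ⟨F, hF⟩ := hM.exists_derives hd (by simpa using card_le_univ (univ.biUnion T.fibre))
      _ hpos hsum
    refine ⟨_, _, F, hF, ⟨_, rfl⟩, ?_⟩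
    have := (hM.isLinkageSystem.hasTopes_and_topesUnique (by simpa using hd)).2 _ hpos hsum _ rfl
      _ _ (hF.isCompatible hM ⟨_, rfl⟩) h
    simpa using congrArg BipGraph.ofFibres this

theorem card_tope_sdiff (M : MatchingField n d) (σ σ' : KSubset n d) :
    (M.tope σ \ M.tope σ').card = hammingDist (M.function σ) (M.function σ') := by
  symm
  refine card_bij (fun i _ => (M.function σ i, i)) ?_ ?_ ?_
  · intro i hi
    rw [mem_sdiff]
    exact ⟨M.function_mem σ i, fun h => (mem_filter.1 hi).2 (M.mem_tope_iff.1 h)⟩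
  · intro i _ l _ h
    exact (Prod.ext_iff.1 h).2
  · rintro ⟨x, i⟩ h
    rw [mem_sdiff, mem_tope_iff, mem_tope_iff] at h
    obtain ⟨rfl, h⟩ := h
    exact ⟨i, mem_filter.2 ⟨mem_univ i, h⟩, rfl⟩

theorem flipGraph_adj_iff (M : MatchingField n d) (σ σ' : KSubset n d) :
    M.flipGraph.Adj σ σ' ↔ hammingDist (M.function σ) (M.function σ') = 1 := by
  change (M.tope σ \ M.tope σ').card = 1 ∧ (M.tope σ' \ M.tope σ).card = 1 ↔ _
  rw [card_tope_sdiff, card_tope_sdiff, hammingDist_comm (M.function σ'), and_self]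

theorem mem_fibre_unionMatchings (M : MatchingField n d) {U : Finset (KSubset n d)} {i : Fin d}
    {x : Fin n} : x ∈ (M.unionMatchings U).fibre i ↔ ∃ σ ∈ U, M.function σ i = x := by
  simp [unionMatchings, mem_tope_iff, eq_comm]

/-- The fibres of the union are the coordinate projections of the cell, and the cell is the product
of its projections by the Hamming embedding result. -/
theorem exists_mem_verts_of_forall_mem_fibre {M : MatchingField n d} (hd : 1 ≤ d)
    (U : ProdsimplicialCell M.flipGraph) {s : Fin d → Fin n}
    (hs : ∀ i, s i ∈ (M.unionMatchings U.verts).fibre i) :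
    ∃ σ ∈ U.verts, M.function σ = s := by
  have : Nonempty (Fin d) := ⟨⟨0, hd⟩⟩
  obtain ⟨m, a, ⟨φ⟩⟩ := U.isProd
  obtain ⟨x, hx⟩ := exists_eq_of_hammingDist_embedding
    (ψ := fun x => M.function (φ.symm x).1)
    (fun x y h => φ.symm.injective (Subtype.ext (M.function_injective h)))
    (fun x y => by
      rw [← flipGraph_adj_iff]
      exact φ.symm.map_rel_iff) s
    (fun i => by
      obtain ⟨σ, hσ, h⟩ := M.mem_fibre_unionMatchings.1 (hs i)
      exact ⟨φ ⟨σ, hσ⟩, by simpa using h⟩)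
  exact ⟨_, (φ.symm x).2, hx⟩

theorem isProduct_fibre_unionMatchings {M : MatchingField n d} (hd : 1 ≤ d)
    (U : ProdsimplicialCell M.flipGraph) : M.IsProduct (M.unionMatchings U.verts).fibre := by
  constructor
  · intro i
    obtain ⟨m, a, ⟨φ⟩⟩ := U.isProd
    exact ⟨_, M.mem_fibre_unionMatchings.2 ⟨_, (φ.symm fun _ => 0).2, rfl⟩⟩
  · intro s hs
    obtain ⟨σ, -, hσ⟩ := exists_mem_verts_of_forall_mem_fibre hd U hs
    exact M.mem_functions_iff.2 ⟨σ, hσ⟩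

theorem mem_verts_iff {M : MatchingField n d} (hd : 1 ≤ d)
    (U : ProdsimplicialCell M.flipGraph) (σ : KSubset n d) :
    σ ∈ U.verts ↔ ∀ i, M.function σ i ∈ (M.unionMatchings U.verts).fibre i := by
  constructor
  · exact fun h i => M.mem_fibre_unionMatchings.2 ⟨σ, h, rfl⟩
  · intro h
    obtain ⟨σ', hσ', e⟩ := exists_mem_verts_of_forall_mem_fibre hd U h
    rwa [← M.function_injective e]

/-- The matchings that are contained in `T` span the `1`-skeleton of a product of simplices whose
factors have the sets `T t` as vertices. -/
theorem IsProduct.exists_iso {M : MatchingField n d} {T : Fin d → Finset (Fin n)}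
    (hT : M.IsProduct T) {W : Finset (KSubset n d)}
    (hW : ∀ σ, σ ∈ W ↔ ∀ i, M.function σ i ∈ T i) :
    ∃ (a : Fin d → ℕ) (φ : M.flipGraph.induce (W : Set (KSubset n d)) ≃g prodSimplexGraph a)
      (e : ∀ t, {x // x ∈ T t} ≃ Fin (a t + 1)),
      ∀ (σ : KSubset n d) (hσ : σ ∈ W) (t : Fin d),
        φ ⟨σ, hσ⟩ t = e t ⟨M.function σ t, (hW σ).1 hσ t⟩ := by
  -- A simplex of dimension `a t` has `a t + 1` vertices.
  let a : Fin d → ℕ := fun t => (T t).card - 1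
  have ha : ∀ t, (T t).card = a t + 1 := fun t => by
    have := card_pos.2 (hT.1 t)
    simp only [a]
    omega
  let e : ∀ t, {x // x ∈ T t} ≃ Fin (a t + 1) := fun t => (T t).equivFinOfCardEq (ha t)
  let f : {σ // σ ∈ (W : Set (KSubset n d))} → ∀ t, Fin (a t + 1) :=
    fun σ t => e t ⟨M.function σ.1 t, (hW σ.1).1 σ.2 t⟩
  have hf : Function.Bijective f := by
    constructor
    · intro σ σ' h
      refine Subtype.ext (M.function_injective (funext fun t => ?_))
      exact Subtype.ext_iff.1 ((e t).injective (congrFun h t))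
    · intro x
      obtain ⟨σ, hσ⟩ := M.mem_functions_iff.1
        (hT.2 (fun t => ((e t).symm (x t)).1) fun t => ((e t).symm (x t)).2)
      refine ⟨⟨σ, (hW σ).2 fun i => ?_⟩, funext fun t => ?_⟩
      · rw [hσ]; exact ((e i).symm (x i)).2
      · simp only [f]
        rw [← Equiv.eq_symm_apply]
        exact Subtype.ext (congrFun hσ t)
  refine ⟨a, ⟨Equiv.ofBijective f hf, ?_⟩, e, fun σ hσ t => rfl⟩
  intro σ σ'
  change hammingDist (f σ) (f σ') = 1 ↔ M.flipGraph.Adj σ.1 σ'.1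
  rw [flipGraph_adj_iff]
  have : hammingDist (f σ) (f σ') = hammingDist (M.function σ.1) (M.function σ'.1) := by
    unfold hammingDist
    congr 1
    ext t
    simp [f]
  rw [this]

theorem IsProduct.exists_cell {M : MatchingField n d} {T : Fin d → Finset (Fin n)}
    (hT : M.IsProduct T) :
    ∃ U : ProdsimplicialCell M.flipGraph, (M.unionMatchings U.verts).fibre = T := by
  classical
  let W : Finset (KSubset n d) := univ.filter fun σ => ∀ i, M.function σ i ∈ T i
  have hW : ∀ σ, σ ∈ W ↔ ∀ i, M.function σ i ∈ T i := fun σ => by simp [W]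
  obtain ⟨a, φ, -⟩ := hT.exists_iso hW
  refine ⟨⟨W, d, a, ⟨φ⟩⟩, ?_⟩
  ext i x
  rw [mem_fibre_unionMatchings]
  constructor
  · rintro ⟨σ, hσ, rfl⟩
    exact (hW σ).1 hσ i
  · intro hx
    choose s hs using hT.1
    have hs' : ∀ k, Function.update s i x k ∈ T k := fun k => by
      by_cases hk : k = i
      · subst hk; simpa using hx
      · simpa [hk] using hs k
    obtain ⟨σ, hσ⟩ := M.mem_functions_iff.1 (hT.2 _ hs')
    exact ⟨σ, (hW σ).2 (by rw [hσ]; exact hs'), by rw [hσ]; simp⟩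

/-- When the union of `U` is contained in that of `W`, the fibres of `U` are nonempty subsets of
those of `W`, that is, nonempty faces of the factors of `W`. -/
theorem isFace_iff {M : MatchingField n d} (hd : 1 ≤ d) (U W : ProdsimplicialCell M.flipGraph) :
    U ≤ W ↔ M.unionMatchings U.verts ⊆ M.unionMatchings W.verts := by
  constructor
  · rintro ⟨m, a, φ, S, -, h⟩
    exact biUnion_subset_biUnion_of_subset_left _ fun σ hσ => ((h σ).1 hσ).1
  · intro hUW
    rw [BipGraph.subset_iff_fibre] at hUW
    obtain ⟨a, φ, e, hφ⟩ := (isProduct_fibre_unionMatchings hd W).exists_iso (mem_verts_iff hd W)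
    refine ⟨d, a, φ, fun t => {c | ((e t).symm c).1 ∈ (M.unionMatchings U.verts).fibre t},
      fun t => ?_, fun σ => ?_⟩
    · obtain ⟨x, hx⟩ := (isProduct_fibre_unionMatchings hd U).1 t
      exact ⟨e t ⟨x, hUW t hx⟩, by simpa using hx⟩
    · rw [mem_verts_iff hd U]
      constructor
      · intro h
        have hσ := (mem_verts_iff hd W σ).2 fun i => hUW i (h i)
        refine ⟨hσ, fun t => ?_⟩
        have := h t
        rw [Set.mem_ofPred_eq, hφ σ hσ t, Equiv.symm_apply_apply]
        exact this
      · rintro ⟨hσ, h⟩ t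
        have := h t
        rwa [Set.mem_ofPred_eq, hφ σ hσ t, Equiv.symm_apply_apply] at this

end MatchingField

/-! ### Lattices by adjoining a least and a greatest element -/

section OrderTheory

/-- Only `LE` is assumed because the face relation on cells is not known in advance to be a partial
order; lattice properties are transported from the derived topes. -/
theorem OrderIso.exists_isGLB_and_isLUB_pair {α β : Type*} [LE α] [LE β] (e : α ≃o β)
    (h : ∀ x y : β, (∃ z, IsGLB {x, y} z) ∧ ∃ z, IsLUB {x, y} z) (x y : α) :
    (∃ z, IsGLB {x, y} z) ∧ ∃ z, IsLUB {x, y} z := by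
  have hle : ∀ a b, a ≤ e.symm b ↔ e a ≤ b := fun a b => by
    rw [← e.le_iff_le, e.apply_symm_apply]
  have hge : ∀ a b, e.symm b ≤ a ↔ b ≤ e a := fun a b => by
    rw [← e.le_iff_le, e.apply_symm_apply]
  obtain ⟨⟨z, hz⟩, w, hw⟩ := h (e x) (e y)
  refine ⟨⟨e.symm z, ?_, ?_⟩, e.symm w, ?_, ?_⟩
  · rintro a (rfl | rfl)
    · exact (hge _ _).2 (hz.1 (Or.inl rfl))
    · exact (hge _ _).2 (hz.1 (Or.inr rfl))
  · intro a ha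
    refine (hle _ _).2 (hz.2 ?_)
    rintro b (rfl | rfl)
    · exact e.le_iff_le.2 (ha (Or.inl rfl))
    · exact e.le_iff_le.2 (ha (Or.inr rfl))
  · rintro a (rfl | rfl)
    · exact (hle _ _).2 (hw.1 (Or.inl rfl))
    · exact (hle _ _).2 (hw.1 (Or.inr rfl))
  · intro a ha
    refine (hge _ _).2 (hw.2 ?_)
    rintro b (rfl | rfl)
    · exact e.le_iff_le.2 (ha (Or.inl rfl))
    · exact e.le_iff_le.2 (ha (Or.inr rfl))

/-- In a finite partial order with a greatest element, binary suprema exist if binary infima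
do. -/
theorem exists_isLUB_pair_of_exists_isGLB_pair {α : Type*} [PartialOrder α] [OrderTop α]
    [Finite α] (h : ∀ x y : α, ∃ z, IsGLB {x, y} z) (x y : α) : ∃ z, IsLUB {x, y} z := by
  have key : ∀ s : Set α, s.Finite → ∃ z, IsGLB s z := by
    intro s hs
    induction s, hs using Set.Finite.induction_on with
    | empty => exact ⟨⊤, by simp⟩
    | @insert a s _ _ ih =>
      obtain ⟨z, hz⟩ := ih
      obtain ⟨w, hw⟩ := h a z
      refine ⟨w, ?_⟩
      rw [isGLB_iff_le_iff] at hz hw ⊢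
      intro b
      rw [hw b, lowerBounds_insert, lowerBounds_insert, Set.mem_inter_iff, Set.mem_inter_iff,
        lowerBounds_singleton, Set.mem_Iic, Set.mem_Iic, hz b]
  -- The supremum is the infimum of all upper bounds.
  obtain ⟨z, hz⟩ := key (upperBounds {x, y}) (Set.toFinite _)
  exact ⟨z, isGLB_upperBounds.1 hz⟩

/-- Adjoining a least and a greatest element turns a finite partial order in which bounded below
pairs have infima into a lattice. -/
theorem FaceLattice.exists_isGLB_and_isLUB_pair {P : Type*} [PartialOrder P] [Finite P]
    (h : ∀ x y w : P, w ≤ x → w ≤ y → ∃ z, IsGLB {x, y} z) (x y : FaceLattice P) :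
    (∃ z, IsGLB {x, y} z) ∧ ∃ z, IsLUB {x, y} z := by
  classical
  have : Finite (FaceLattice P) := inferInstanceAs (Finite (Option (Option P)))
  have hglb : ∀ x y : FaceLattice P, ∃ z, IsGLB {x, y} z := by
    have of_le : ∀ x y : FaceLattice P, x ≤ y → IsGLB {x, y} x := fun x y hxy =>
      IsLeast.isGLB ⟨by simp, by
        rw [mem_lowerBounds]
        rintro z (rfl | rfl)
        · exact le_rfl
        · exact hxy⟩
    intro x y
    by_cases hxy : x ≤ y
    · exact ⟨x, of_le x y hxy⟩
    by_cases hyx : y ≤ x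
    · exact ⟨y, by rw [Set.pair_comm]; exact of_le y x hyx⟩
    induction x using WithBot.recBotCoe with
    | bot => exact absurd bot_le hxy
    | coe x =>
    induction y using WithBot.recBotCoe with
    | bot => exact absurd bot_le hyx
    | coe y =>
    induction x using WithTop.recTopCoe with
    | top => exact absurd (WithBot.coe_le_coe.2 le_top) hyx
    | coe x =>
    induction y using WithTop.recTopCoe with
    | top => exact absurd (WithBot.coe_le_coe.2 le_top) hxy
    | coe y =>
    by_cases hw : ∃ w, w ≤ x ∧ w ≤ y
    · obtain ⟨w, hwx, hwy⟩ := hw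
      obtain ⟨z, hz⟩ := h x y w hwx hwy
      refine ⟨((z : WithTop P) : FaceLattice P), ?_⟩
      rw [isGLB_iff_le_iff] at hz ⊢
      intro b
      induction b using WithBot.recBotCoe with
      | bot => simp
      | coe b =>
      induction b using WithTop.recTopCoe with
      | top => simp
      | coe b =>
        have := hz b
        simp only [lowerBounds_insert, lowerBounds_singleton, Set.mem_inter_iff, Set.mem_Iic,
          WithBot.coe_le_coe, WithTop.coe_le_coe] at this ⊢
        exact this
    · refine ⟨⊥, ?_⟩
      rw [isGLB_iff_le_iff]
      intro b
      simp only [lowerBounds_insert, lowerBounds_singleton, Set.mem_inter_iff, Set.mem_Iic]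
      induction b using WithBot.recBotCoe with
      | bot => simp
      | coe b =>
      induction b using WithTop.recTopCoe with
      | top => simp
      | coe b =>
        simp only [WithBot.coe_le_coe, WithTop.coe_le_coe]
        constructor
        · intro hb
          simp at hb
        · intro hb
          exact absurd ⟨b, hb⟩ hw
  exact ⟨hglb x y, exists_isLUB_pair_of_exists_isGLB_pair hglb x y⟩

/-- An order isomorphism extends to the orders with a least and a greatest element adjoined. -/
def OrderIso.faceLatticeCongr {P Q : Type*} [LE P] [LE Q] (e : P ≃o Q) :
    FaceLattice P ≃o FaceLattice Q where
  toEquiv := e.toEquiv.withTopCongr.withBotCongr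
  map_rel_iff' := by
    have htop : ∀ x y : WithTop P, WithTop.map e x ≤ WithTop.map e y ↔ x ≤ y := fun x y => by
      induction y using WithTop.recTopCoe with
      | top => simp
      | coe y =>
      induction x using WithTop.recTopCoe with
      | top => simp
      | coe x => simp
    intro x y
    induction x using WithBot.recBotCoe with
    | bot => simp
    | coe x =>
    induction y using WithBot.recBotCoe with
    | bot => simp
    | coe y => exact WithBot.coe_le_coe.trans ((htop x y).trans WithBot.coe_le_coe.symm)

end OrderTheory

/-! ### The isomorphism of posets and the maximal cells -/

namespace MatchingField

open Finset

variable {n d : ℕ} {M : MatchingField n d}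

theorem unionMatchings_injective (hd : 1 ≤ d) {U W : ProdsimplicialCell M.flipGraph}
    (h : M.unionMatchings U.verts = M.unionMatchings W.verts) : U = W := by
  have : U.verts = W.verts := by
    ext σ
    rw [mem_verts_iff hd U, mem_verts_iff hd W, h]
  cases U
  cases W
  cases this
  rfl

/-- Mapping a cell to the union of its matchings is an isomorphism from the poset of cells to the
poset of derived topes. -/
noncomputable def cellOrderIso (hd : 1 ≤ d) (hM : M.IsLinkage) :
    ProdsimplicialCell M.flipGraph ≃o M.DerivedTope where
  toEquiv := Equiv.ofBijective
    (fun U => ⟨M.unionMatchings U.verts,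
      (mem_derivedTopes_iff hM).2 (isProduct_fibre_unionMatchings hd U)⟩) <| by
    constructor
    · exact fun U W h => unionMatchings_injective hd (Subtype.ext_iff.1 h)
    · rintro ⟨T, hT⟩
      obtain ⟨U, hU⟩ := ((mem_derivedTopes_iff hM).1 hT).exists_cell
      exact ⟨U, Subtype.ext (by simpa using congrArg BipGraph.ofFibres hU)⟩
  map_rel_iff' := by
    intro U W
    exact (isFace_iff hd U W).symm

/-- The infimum is the intersection of edge sets; the common lower bound `w` keeps its fibres
nonempty. -/
theorem exists_isGLB_derivedTope (hM : M.IsLinkage) (x y w : M.DerivedTope) (hx : w ≤ x)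
    (hy : w ≤ y) : ∃ z, IsGLB {x, y} z := by
  have hP : M.IsProduct (x.1 ∩ y.1 : BipGraph n d).fibre := by
    constructor
    · intro i
      obtain ⟨a, ha⟩ := ((mem_derivedTopes_iff hM).1 w.2).1 i
      have ha := BipGraph.mem_fibre.1 ha
      exact ⟨a, BipGraph.mem_fibre.2 (mem_inter.2 ⟨hx ha, hy ha⟩)⟩
    · intro s hs
      refine ((mem_derivedTopes_iff hM).1 x.2).2 s fun i => ?_
      exact BipGraph.mem_fibre.2 (mem_inter.1 (BipGraph.mem_fibre.1 (hs i))).1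
  refine ⟨⟨x.1 ∩ y.1, (mem_derivedTopes_iff hM).2 hP⟩, ?_⟩
  rw [isGLB_iff_le_iff]
  intro b
  simp only [lowerBounds_insert, lowerBounds_singleton, Set.mem_inter_iff, Set.mem_Iic]
  exact subset_inter_iff

theorem IsProduct.eq_of_subset {T T' : Fin d → Finset (Fin n)} (hT' : M.IsProduct T')
    (hT : ∀ x, ∃ i, x ∈ T i) (h : ∀ i, T i ⊆ T' i) : T' = T := by
  ext i x
  refine ⟨fun hx => ?_, fun hx => h i hx⟩
  obtain ⟨l, hl⟩ := hT x
  rwa [hT'.isCompatible.unique hx (h l hl)]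

/-- The right node that receives `j` is read off from the tope `P` of the same type on the support
with another node `x` exchanged for `j`. If `j ∈ P i`, then `j` lies in the `i`-th fibre of the tope
of type `v + e_i`, and removing it gives back `T` by uniqueness. -/
theorem IsProduct.exists_extension (hd : 1 ≤ d) (hM : M.IsLinkage) {T : Fin d → Finset (Fin n)}
    (hT : M.IsProduct T) {j : Fin n} (hj : ∀ i, j ∉ T i) :
    ∃ T', M.IsProduct T' ∧ (∀ i, T i ⊆ T' i) ∧ ∃ i, j ∈ T' i := by
  have hC := hT.isCompatible
  have hpos : ∀ i, 0 < (T i).card := fun i => card_pos.2 (hT.1 i)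
  have hsum := hT.sum_card_eq
  set v : Fin d → ℕ := fun i => (T i).card
  set σ := univ.biUnion T
  have hdσ : Fintype.card (Fin d) ≤ σ.card := by simpa using hT.le_card_biUnion
  have hjσ : j ∉ σ := fun h => by
    obtain ⟨i, hi⟩ := (hC.mem_iff j).1 h
    exact hj i hi
  obtain ⟨hex, hun⟩ := hM.isLinkageSystem.hasTopes_and_topesUnique hdσ
  obtain ⟨hex', -⟩ := hM.isLinkageSystem.hasTopes_and_topesUnique (Nat.le_succ_of_le hdσ)
  have hτ : (insert j σ).card = σ.card + 1 := card_insert_of_notMem hjσ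
  obtain ⟨x, hx⟩ : σ.Nonempty := by
    obtain ⟨x, hx⟩ := hT.1 ⟨0, hd⟩
    exact ⟨x, hC.subset _ hx⟩
  have hxj : x ≠ j := fun e => hjσ (e ▸ hx)
  have hxτ : x ∈ insert j σ := mem_insert_of_mem hx
  obtain ⟨P, hP⟩ := hex v hpos hsum ((insert j σ).erase x)
    (by rw [card_erase_of_mem hxτ, hτ]; rfl)
  obtain ⟨i, hi⟩ := (hP.mem_iff j).1 (mem_erase.2 ⟨hxj.symm, mem_insert_self _ _⟩)
  obtain ⟨T', hT'⟩ := hex' (v + Pi.single i 1) (add_single_pos hpos i)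
    (by rw [sum_add_single, hsum]) _ hτ
  obtain ⟨y, -, hy⟩ := hT'.exists_eq_erase hex hun hex' hpos hsum hτ hxτ hP
  have hjT' : j ∈ T' i := by rw [hy] at hi; exact mem_of_mem_erase hi
  have hC' := hT'.eraseNode hjT'
  rw [erase_insert hjσ] at hC'
  have heq := hun v hpos hsum σ rfl _ _ hC hC'
  refine ⟨T', ⟨fun k => card_pos.1 ?_, hT'.mem_of_transversal⟩, fun k z hz => ?_, i, hjT'⟩
  · rw [hT'.card_eq]; exact add_single_pos hpos i k
  · rw [heq] at hz
    exact (mem_eraseNode.1 hz).2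

theorem isMax_iff (hd : 1 ≤ d) (hM : M.IsLinkage) (U : ProdsimplicialCell M.flipGraph) :
    IsMax U ↔ ∀ x, ∃ i, x ∈ (M.unionMatchings U.verts).fibre i := by
  constructor
  · intro hU
    by_contra! h
    obtain ⟨j, hj⟩ := h
    obtain ⟨T', hT', hsub, i, hi⟩ := (isProduct_fibre_unionMatchings hd U).exists_extension hd hM hj
    obtain ⟨W, rfl⟩ := hT'.exists_cell
    have := hU ((isFace_iff hd U W).2 (BipGraph.subset_iff_fibre.2 hsub))
    exact hj i (BipGraph.subset_iff_fibre.1 ((isFace_iff hd W U).1 this) i hi)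
  · intro hU W hUW
    rw [isFace_iff hd, BipGraph.subset_iff_fibre] at hUW ⊢
    rw [(isProduct_fibre_unionMatchings hd W).eq_of_subset hU hUW]
    exact fun i => Subset.rfl

theorem biUnion_eq_univ {T : Fin d → Finset (Fin n)} (hT : ∀ x, ∃ i, x ∈ T i) :
    univ.biUnion T = univ := by
  ext x
  simpa using hT x

/-- Maximal cells are the products covering all left nodes, so injectivity is uniqueness and
surjectivity is existence of compatible topes at thickness `n`. -/
theorem exists_maximalCells_equiv (hd : 1 ≤ d) (hdn : d ≤ n) (hM : M.IsLinkage) :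
    ∃ f : {U : ProdsimplicialCell M.flipGraph // IsMax U} ≃ dilatedSimplexPoints n d,
      ∀ (U : {U : ProdsimplicialCell M.flipGraph // IsMax U}) (i : Fin d),
        (f U).1 i + 1 = ((M.unionMatchings U.1.verts).rightDegree i : ℤ) := by
  obtain ⟨hex, hun⟩ := hM.isLinkageSystem.hasTopes_and_topesUnique
    (show Fintype.card (Fin d) ≤ n by simpa using hdn)
  have hprod : ∀ U : ProdsimplicialCell M.flipGraph,
      M.IsProduct (M.unionMatchings U.verts).fibre := isProduct_fibre_unionMatchings hd
  have hpos : ∀ (U : ProdsimplicialCell M.flipGraph) i,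
      0 < (M.unionMatchings U.verts).rightDegree i := fun U i => by
    rw [← BipGraph.card_fibre]
    exact card_pos.2 ((hprod U).1 i)
  have huniv : ∀ U : {U : ProdsimplicialCell M.flipGraph // IsMax U},
      univ.biUnion (M.unionMatchings U.1.verts).fibre = univ := fun U =>
    biUnion_eq_univ ((isMax_iff hd hM U.1).1 U.2)
  have hsum : ∀ U : {U : ProdsimplicialCell M.flipGraph // IsMax U},
      ∑ i, (M.unionMatchings U.1.verts).rightDegree i = n := fun U => by
    have := (hprod U.1).sum_card_eq
    rw [huniv U] at this
    simpa [BipGraph.card_fibre] using this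
  let f : {U : ProdsimplicialCell M.flipGraph // IsMax U} → dilatedSimplexPoints n d := fun U =>
    ⟨fun i => ((M.unionMatchings U.1.verts).rightDegree i : ℤ) - 1, fun i => by
      have := hpos U.1 i
      change (0 : ℤ) ≤ ((M.unionMatchings U.1.verts).rightDegree i : ℤ) - 1
      omega, by
      rw [Finset.sum_sub_distrib]
      have := congrArg (Nat.cast : ℕ → ℤ) (hsum U)
      push_cast at this
      rw [this]
      simp⟩
  have hf : Function.Bijective f := by
    constructor
    · intro U W h
      have hdeg : ∀ i, (M.unionMatchings U.1.verts).rightDegree i =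
          (M.unionMatchings W.1.verts).rightDegree i := fun i => by
        have := congrFun (Subtype.ext_iff.1 h) i
        simp only [f] at this
        omega
      have h1 := (hprod U.1).isCompatible
      have h2 := (hprod W.1).isCompatible
      rw [huniv] at h1 h2
      simp only [BipGraph.card_fibre] at h1 h2
      rw [← funext hdeg] at h2
      have := hun _ (hpos U.1) (hsum U) univ (by simp) _ _ h1 h2
      refine Subtype.ext (unionMatchings_injective hd ?_)
      simpa using congrArg BipGraph.ofFibres this
    · rintro ⟨p, hp0, hp⟩
      have hw : ∀ i, 0 < (p i + 1).toNat := fun i => by have := hp0 i; omega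
      have hwsum : ∑ i, (p i + 1).toNat = n := by
        zify
        rw [Finset.sum_congr rfl fun i _ => Int.toNat_of_nonneg (by have := hp0 i; omega),
          Finset.sum_add_distrib, hp]
        simp
      obtain ⟨T, hT⟩ := hex _ hw hwsum univ (by simp)
      have hTp : M.IsProduct T :=
        ⟨fun i => card_pos.1 (by rw [hT.card_eq]; exact hw i), hT.mem_of_transversal⟩
      obtain ⟨U, hU⟩ := hTp.exists_cell
      refine ⟨⟨U, (isMax_iff hd hM U).2 fun x => ?_⟩, Subtype.ext (funext fun i => ?_)⟩
      · rw [hU]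
        exact (hT.mem_iff x).1 (mem_univ x)
      · simp only [f]
        rw [← BipGraph.card_fibre, hU, hT.card_eq]
        have := hp0 i
        omega
  refine ⟨Equiv.ofBijective f hf, fun U i => ?_⟩
  simp [f]

end MatchingField

theorem mainTheorem7 (n d : ℕ) (hd : 1 ≤ d) (hdn : d ≤ n)
    (M : MatchingField n d) (hM : M.IsLinkage) :
    (∃ e : FaceLattice (ProdsimplicialCell M.flipGraph) ≃o FaceLattice M.DerivedTope,
      ∀ U : ProdsimplicialCell M.flipGraph, ∃ T : M.DerivedTope,
        e ((U : WithTop (ProdsimplicialCell M.flipGraph)) :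
          FaceLattice (ProdsimplicialCell M.flipGraph)) =
            ((T : WithTop M.DerivedTope) : FaceLattice M.DerivedTope) ∧
        T.1 = M.unionMatchings U.verts) ∧
    (∀ x y : FaceLattice (ProdsimplicialCell M.flipGraph),
      (∃ z, IsGLB {x, y} z) ∧ ∃ z, IsLUB {x, y} z) ∧
    (∃ f : {U : ProdsimplicialCell M.flipGraph // IsMax U} ≃ dilatedSimplexPoints n d,
      ∀ (U : {U : ProdsimplicialCell M.flipGraph // IsMax U}) (i : Fin d),
        (f U).1 i + 1 = ((M.unionMatchings U.1.verts).rightDegree i : ℤ)) := by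
  refine ⟨⟨(MatchingField.cellOrderIso hd hM).faceLatticeCongr,
    fun U => ⟨MatchingField.cellOrderIso hd hM U, rfl, rfl⟩⟩, ?_,
    MatchingField.exists_maximalCells_equiv hd hdn hM⟩
  exact (MatchingField.cellOrderIso hd hM).faceLatticeCongr.exists_isGLB_and_isLUB_pair
    (FaceLattice.exists_isGLB_and_isLUB_pair (MatchingField.exists_isGLB_derivedTope hM))
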